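/- Let $0<q<1$. Let $\mathcal F(x_1,x_2)$ be the free unital complex $*$-algebra on $x_1,x_2$, and consider all unital $*$-representations $\pi$ of it by bounded operators on Hilbert spaces such that $X_i=\pi(x_i)$ satisfy $$X_1X_2=0,\qquad X_1^*X_2=0,\qquad X_2^*X_2-qX_2X_2^*=(1-q)1,$$ $$X_1^*X_1-qX_1X_1^*=(1-q)\bigl(1-X_2|X_2|^{-2}X_2^*\bigr),$$ where $|X_2|^{-2}=(X_2^*X_2)^{-1}$ (the third relation makes $X_2^*X_2$ invertible). Put $\|a\|_0=\sup_\pi\|\pi(a)\|$ (which is finite), $J_0=\{a:\|a\|_0=0\}$ and $P(B_q^4)=\mathcal F(x_1,x_2)/J_0$, and let $C^*(x_1,x_2)$ be the completion of $P(B_q^4)$ in the norm induced by $\|\cdot\|_0$. Let $E_2$ be the directed graph with vertices $u,v,w$ and edges $a:u\to u$, $b:v\to v$, $c:u\to v$, $d:u\to w$, $e:v\to w$, and let $C(B_q^4)=C^*(E_2)$ be its graph $C^*$-algebra, i.e. the $C^*$-algebra generated by the universal family of mutually orthogonal projections $P_u,P_v,P_w$ and partial isometries $S_a,\dots,S_e$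 with $$S_a^*S_a=P_u,\quad S_b^*S_b=S_c^*S_c=P_v,\quad S_d^*S_d=S_e^*S_e=P_w,$$ $$P_u=S_aS_a^*+S_cS_c^*+S_dS_d^*,\quad P_v=S_bS_b^*+S_eS_e^*.$$ Put $S_1=S_b+S_e$, $S_2=S_a+S_c+S_d$ and $\lambda_k=\sqrt{1-q^{k+1}}-\sqrt{1-q^k}$. Then for $i=1,2$ the series $z_i=\sum_{k=0}^\infty\lambda_kS_i^{k+1}(S_i^*)^k$ (where the term for $k=0$ is $\lambda_0S_i$) converges in norm in $C^*(E_2)$, and there is a $*$-isomorphism $C^*(x_1,x_2)\to C(B_q^4)=C^*(E_2)$ with $x_i\mapsto z_i$ for $i=1,2$. -/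

import Mathlib

noncomputable section

namespace QBall

/-! ### The free unital `*`-algebra on a set -/

/-- The free unital complex `*`-algebra on `G`: complex combinations of words in letters
`inl g` (standing for the generator `g`) and `inr g` (standing for its adjoint `g^*`). -/
abbrev FreeStar (G : Type) : Type := MonoidAlgebra ℂ (FreeMonoid (G ⊕ G))

namespace FreeStar

variable {G : Type}

/-- Reversal of words, exchanging `g` and `g^*`. -/
def starWord (G : Type) : FreeMonoid (G ⊕ G) →* (FreeStar G)ᵐᵒᵖ :=
  FreeMonoid.lift fun s =>
    MulOpposite.op (MonoidAlgebra.of ℂ (FreeMonoid (G ⊕ G)) (FreeMonoid.of s.swap))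

/-- The conjugate-linear anti-homomorphism which exchanges `g` and `g^*`. -/
def starHom (G : Type) : FreeStar G →+* (FreeStar G)ᵐᵒᵖ :=
  MonoidAlgebra.liftNCRingHom
    ((algebraMap ℂ (FreeStar G)ᵐᵒᵖ).comp (starRingEnd ℂ))
    (starWord G)
    (fun r y => Algebra.commute_algebraMap_left (A := (FreeStar G)ᵐᵒᵖ)
      (starRingEnd ℂ r) (starWord G y))

theorem starHom_smul (c : ℂ) (a : FreeStar G) :
    starHom G (c • a) = (starRingEnd ℂ c) • starHom G a := by
  have h : starHom G (algebraMap ℂ (FreeStar G) c)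
      = algebraMap ℂ (FreeStar G)ᵐᵒᵖ (starRingEnd ℂ c) := by
    simp [starHom, starWord]
  rw [Algebra.smul_def, map_mul, h, Algebra.smul_def]

theorem starHom_of (s : G ⊕ G) :
    starHom G (MonoidAlgebra.of ℂ _ (FreeMonoid.of s))
      = MulOpposite.op (MonoidAlgebra.of ℂ (FreeMonoid (G ⊕ G)) (FreeMonoid.of s.swap)) := by
  simp [starHom, starWord, MonoidAlgebra.one_def]

/-- Induction principle of the free `*`-algebra. -/
theorem induct {p : FreeStar G → Prop}
    (one : p 1) (add : ∀ a b, p a → p b → p (a + b)) (smul : ∀ (c : ℂ) a, p a → p (c • a))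
    (mul : ∀ (s : G ⊕ G) a, p a → p (MonoidAlgebra.of ℂ _ (FreeMonoid.of s) * a))
    (a : FreeStar G) : p a := by
  induction a using MonoidAlgebra.induction_on with
  | of w =>
    induction w using FreeMonoid.recOn with
    | one => rw [map_one]; exact one
    | of_mul s w hw => rw [map_mul]; exact mul s _ hw
  | add a b ha hb => exact add a b ha hb
  | smul c a ha => exact smul c a ha

theorem starHom_starHom (a : FreeStar G) : (starHom G (starHom G a).unop).unop = a := by
  induction a using induct with
  | one => simp
  | add a b ha hb => simp [ha, hb]
  | smul c a ha => simp [starHom_smul, ha]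
  | mul s a ha => simp only [map_mul, starHom_of, MulOpposite.unop_mul, MulOpposite.unop_op, ha,
      Sum.swap_swap]

instance : StarRing (FreeStar G) where
  star a := (starHom G a).unop
  star_involutive := starHom_starHom
  star_mul a b := by simp
  star_add a b := by simp

theorem star_def (a : FreeStar G) : star a = (starHom G a).unop := rfl

instance : StarModule ℂ (FreeStar G) where
  star_smul c a := by simp [star_def, starHom_smul]

/-- The generators of the free `*`-algebra. -/
def gen (g : G) : FreeStar G := MonoidAlgebra.of ℂ _ (FreeMonoid.of (Sum.inl g))

theorem star_gen (g : G) : star (gen g) = MonoidAlgebra.of ℂ _ (FreeMonoid.of (Sum.inr g)) := by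
  simp [star_def, gen, starHom, starWord]

end FreeStar

/-! ### Universal `C^*`-algebras of generators and relations -/

/-- Generators and relations. The relations are given by the families of bounded Hilbert space
operators which satisfy them; every generator has to be bounded uniformly in these families. -/
structure Presentation (G : Type) where
  /-- The family `T` of bounded operators on the Hilbert space `H` satisfies the relations. -/
  Rel : ∀ (H : Type) [NormedAddCommGroup H] [InnerProductSpace ℂ H] [CompleteSpace H],
    (G → H →L[ℂ] H) → Prop
  bounded : ∀ g : G, ∃ C : ℝ, ∀ (H : Type) [NormedAddCommGroup H] [InnerProductSpace ℂ H]
    [CompleteSpace H] (T : G → H →L[ℂ] H), Rel H T → ‖T g‖ ≤ C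

/-- The free `*`-algebra on `G`, to be equipped with the `C^*`-seminorm of the relations `R`. -/
def Pre {G : Type} (_R : Presentation G) : Type := FreeStar G

namespace Pre

variable {G : Type} (R : Presentation G)

instance : Ring (Pre R) := inferInstanceAs (Ring (FreeStar G))
instance : Algebra ℂ (Pre R) := inferInstanceAs (Algebra ℂ (FreeStar G))
instance : StarRing (Pre R) := inferInstanceAs (StarRing (FreeStar G))
instance : StarModule ℂ (Pre R) := inferInstanceAs (StarModule ℂ (FreeStar G))

/-- The generators of the free `*`-algebra. -/
def gen (g : G) : Pre R := FreeStar.gen g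

/-- Induction principle of the free `*`-algebra, in terms of the generators. -/
theorem induct {p : Pre R → Prop}
    (one : p 1) (add : ∀ a b, p a → p b → p (a + b)) (smul : ∀ (c : ℂ) a, p a → p (c • a))
    (gen_mul : ∀ g a, p a → p (gen R g * a)) (star_gen_mul : ∀ g a, p a → p (star (gen R g) * a))
    (a : Pre R) : p a := by
  refine FreeStar.induct (G := G) (p := p) one add smul (fun s a ha => ?_) a
  cases s with
  | inl g => exact gen_mul g a ha
  | inr g =>
    rw [← FreeStar.star_gen g]
    exact star_gen_mul g a ha

/-- The values `‖π(a)‖`, where `π` runs over the unital `*`-representations of the free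
`*`-algebra on Hilbert spaces which satisfy the relations. -/
def normSet (a : Pre R) : Set ℝ :=
  {r | ∃ (H : Type) (_ : NormedAddCommGroup H) (_ : InnerProductSpace ℂ H) (_ : CompleteSpace H)
    (π : Pre R →⋆ₐ[ℂ] (H →L[ℂ] H)), R.Rel H (fun g => π (gen R g)) ∧ r = ‖π a‖}

theorem bddAbove_normSet (a : Pre R) : BddAbove (normSet R a) := by
  suffices h : ∃ C : ℝ, 0 ≤ C ∧ ∀ (H : Type) [NormedAddCommGroup H] [InnerProductSpace ℂ H]
      [CompleteSpace H] (π : Pre R →⋆ₐ[ℂ] (H →L[ℂ] H)), R.Rel H (fun g => π (gen R g)) →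
      ‖π a‖ ≤ C by
    obtain ⟨C, -, hC⟩ := h
    refine ⟨C, ?_⟩
    rintro r ⟨H, _, _, _, π, hπ, rfl⟩
    exact hC H π hπ
  induction a using Pre.induct with
  | one =>
    refine ⟨1, zero_le_one, fun H _ _ _ π _ => ?_⟩
    rw [map_one]
    exact ContinuousLinearMap.norm_id_le
  | add a b ha hb =>
    obtain ⟨C, hC0, hC⟩ := ha
    obtain ⟨D, hD0, hD⟩ := hb
    refine ⟨C + D, by positivity, fun H _ _ _ π hπ => ?_⟩
    rw [map_add]
    exact (norm_add_le _ _).trans (add_le_add (hC H π hπ) (hD H π hπ))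
  | smul c a ha =>
    obtain ⟨C, hC0, hC⟩ := ha
    refine ⟨‖c‖ * C, by positivity, fun H _ _ _ π hπ => ?_⟩
    rw [map_smul, norm_smul]
    exact mul_le_mul_of_nonneg_left (hC H π hπ) (norm_nonneg _)
  | gen_mul g a ha =>
    obtain ⟨C, hC0, hC⟩ := ha
    obtain ⟨D, hD⟩ := R.bounded g
    refine ⟨|D| * C, by positivity, fun H _ _ _ π hπ => ?_⟩
    rw [map_mul]
    exact (norm_mul_le _ _).trans (mul_le_mul ((hD H _ hπ).trans (le_abs_self D)) (hC H π hπ)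
      (norm_nonneg _) (abs_nonneg D))
  | star_gen_mul g a ha =>
    obtain ⟨C, hC0, hC⟩ := ha
    obtain ⟨D, hD⟩ := R.bounded g
    refine ⟨|D| * C, by positivity, fun H _ _ _ π hπ => ?_⟩
    rw [map_mul, map_star]
    refine (norm_mul_le _ _).trans (mul_le_mul ?_ (hC H π hπ) (norm_nonneg _) (abs_nonneg D))
    rw [norm_star]
    exact (hD H _ hπ).trans (le_abs_self D)

/-- The seminorm `‖a‖₀ = sup ‖π(a)‖`. -/
instance : Norm (Pre R) := ⟨fun a => sSup (normSet R a)⟩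

theorem norm_def (a : Pre R) : ‖a‖ = sSup (normSet R a) := rfl

theorem norm_nonneg' (a : Pre R) : 0 ≤ ‖a‖ := by
  refine Real.sSup_nonneg ?_
  rintro r ⟨H, _, _, _, π, hπ, rfl⟩
  exact norm_nonneg _

theorem le_norm' (a : Pre R) (H : Type) [NormedAddCommGroup H] [InnerProductSpace ℂ H]
    [CompleteSpace H] (π : Pre R →⋆ₐ[ℂ] (H →L[ℂ] H)) (hπ : R.Rel H (fun g => π (gen R g))) :
    ‖π a‖ ≤ ‖a‖ :=
  le_csSup (bddAbove_normSet R a) ⟨H, _, _, _, π, hπ, rfl⟩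

theorem norm_le' (a : Pre R) {C : ℝ} (hC : 0 ≤ C)
    (h : ∀ (H : Type) [NormedAddCommGroup H] [InnerProductSpace ℂ H] [CompleteSpace H]
      (π : Pre R →⋆ₐ[ℂ] (H →L[ℂ] H)), R.Rel H (fun g => π (gen R g)) → ‖π a‖ ≤ C) :
    ‖a‖ ≤ C := by
  refine Real.sSup_le ?_ hC
  rintro r ⟨H, _, _, _, π, hπ, rfl⟩
  exact h H π hπ

theorem norm_smul_le' (c : ℂ) (a : Pre R) : ‖c • a‖ ≤ ‖c‖ * ‖a‖ := by
  refine norm_le' R _ (mul_nonneg (norm_nonneg _) (norm_nonneg' R a)) fun H _ _ _ π hπ => ?_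
  rw [map_smul, norm_smul]
  exact mul_le_mul_of_nonneg_left (le_norm' R a H π hπ) (norm_nonneg _)

/-- `‖·‖₀` as a seminorm of additive groups. -/
def seminorm : AddGroupSeminorm (Pre R) where
  toFun a := ‖a‖
  map_zero' := le_antisymm
    (norm_le' R _ le_rfl fun H _ _ _ π _ => by rw [map_zero, norm_zero]) (norm_nonneg' R _)
  add_le' a b := by
    refine norm_le' R _ (add_nonneg (norm_nonneg' R a) (norm_nonneg' R b))
      fun H _ _ _ π hπ => ?_
    rw [map_add]
    exact (norm_add_le _ _).trans (add_le_add (le_norm' R a H π hπ) (le_norm' R b H π hπ))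
  neg' a := by
    have h : ∀ b : Pre R, ‖-b‖ ≤ ‖b‖ := fun b =>
      norm_le' R _ (norm_nonneg' R b) fun H _ _ _ π hπ => by
        rw [map_neg, norm_neg]; exact le_norm' R b H π hπ
    exact le_antisymm (h a) (by simpa using h (-a))

instance : SeminormedRing (Pre R) where
  __ := (inferInstance : Norm (Pre R))
  __ := (inferInstance : Ring (Pre R))
  __ := (seminorm R).toSeminormedAddCommGroup
  norm_mul_le a b := by
    change ‖a * b‖ ≤ ‖a‖ * ‖b‖
    refine norm_le' R _ (mul_nonneg (norm_nonneg' R a) (norm_nonneg' R b))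
      fun H _ _ _ π hπ => ?_
    rw [map_mul]
    exact (norm_mul_le _ _).trans (mul_le_mul (le_norm' R a H π hπ) (le_norm' R b H π hπ)
      (norm_nonneg _) (norm_nonneg' R a))

instance : NormedAlgebra ℂ (Pre R) where
  norm_smul_le := norm_smul_le' R

theorem norm_star_le (a : Pre R) : ‖star a‖ ≤ ‖a‖ :=
  norm_le' R _ (norm_nonneg' R a) fun H _ _ _ π hπ => by
    rw [map_star, norm_star]; exact le_norm' R a H π hπ

instance : NormedStarGroup (Pre R) where
  norm_star_le := norm_star_le R

theorem norm_mul_self_le (a : Pre R) : ‖a‖ * ‖a‖ ≤ ‖star a * a‖ := by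
  have h : ‖a‖ ≤ Real.sqrt ‖star a * a‖ := by
    refine norm_le' R _ (Real.sqrt_nonneg _) fun H _ _ _ π hπ => ?_
    refine Real.le_sqrt_of_sq_le ?_
    have := le_norm' R (star a * a) H π hπ
    rwa [map_mul, map_star, CStarRing.norm_star_mul_self, ← sq] at this
  calc ‖a‖ * ‖a‖ ≤ Real.sqrt ‖star a * a‖ * Real.sqrt ‖star a * a‖ :=
        mul_le_mul h h (norm_nonneg' R a) (Real.sqrt_nonneg _)
    _ = ‖star a * a‖ := Real.mul_self_sqrt (norm_nonneg' R _)

end Pre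

/-- The quotient of the free `*`-algebra by the ideal `J₀ = {a | ‖a‖₀ = 0}`
(two elements are identified iff `‖a - b‖₀ = 0`), with the norm induced by `‖·‖₀`. -/
def PolyAlg {G : Type} (R : Presentation G) : Type := SeparationQuotient (Pre R)

namespace PolyAlg

variable {G : Type} (R : Presentation G)

instance : NormedRing (PolyAlg R) := inferInstanceAs (NormedRing (SeparationQuotient (Pre R)))
instance : NormedAlgebra ℂ (PolyAlg R) :=
  inferInstanceAs (NormedAlgebra ℂ (SeparationQuotient (Pre R)))

/-- The quotient map. -/
def mk (a : Pre R) : PolyAlg R := SeparationQuotient.mk a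

theorem mk_surjective : Function.Surjective (mk R) := SeparationQuotient.surjective_mk
theorem mk_eq_mk (a b : Pre R) : mk R a = mk R b ↔ ‖a - b‖ = 0 := by
  rw [← dist_eq_norm]
  exact SeparationQuotient.mk_eq_mk.trans Metric.inseparable_iff
theorem norm_mk (a : Pre R) : ‖mk R a‖ = ‖a‖ := rfl
theorem mk_add (a b : Pre R) : mk R (a + b) = mk R a + mk R b := rfl
theorem mk_mul (a b : Pre R) : mk R (a * b) = mk R a * mk R b := rfl
theorem mk_smul (c : ℂ) (a : Pre R) : mk R (c • a) = c • mk R a := rfl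

instance : Star (PolyAlg R) where
  star := SeparationQuotient.lift (fun a => mk R (star a)) fun a b h => by
    rw [mk_eq_mk, ← star_sub, norm_star, ← dist_eq_norm]
    exact Metric.inseparable_iff.1 h

theorem mk_star (a : Pre R) : mk R (star a) = star (mk R a) := rfl

instance : StarRing (PolyAlg R) where
  star_involutive x := by
    obtain ⟨a, rfl⟩ := mk_surjective R x
    rw [← mk_star, ← mk_star, star_star]
  star_mul x y := by
    obtain ⟨a, rfl⟩ := mk_surjective R x
    obtain ⟨b, rfl⟩ := mk_surjective R y
    rw [← mk_mul, ← mk_star, star_mul, mk_mul, mk_star, mk_star]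
  star_add x y := by
    obtain ⟨a, rfl⟩ := mk_surjective R x
    obtain ⟨b, rfl⟩ := mk_surjective R y
    rw [← mk_add, ← mk_star, star_add, mk_add, mk_star, mk_star]

instance : StarModule ℂ (PolyAlg R) where
  star_smul c x := by
    obtain ⟨a, rfl⟩ := mk_surjective R x
    rw [← mk_smul, ← mk_star, star_smul, mk_smul, mk_star]

instance : CStarRing (PolyAlg R) where
  norm_mul_self_le x := by
    obtain ⟨a, rfl⟩ := mk_surjective R x
    rw [← mk_star, ← mk_mul, norm_mk, norm_mk]
    exact Pre.norm_mul_self_le R a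

/-- The generators. -/
def gen (g : G) : PolyAlg R := mk R (Pre.gen R g)

end PolyAlg

/-- The universal unital `C^*`-algebra of the relations `R`: the completion of `PolyAlg R`. -/
def CStar {G : Type} (R : Presentation G) : Type := UniformSpace.Completion (PolyAlg R)

namespace CStar

open UniformSpace

variable {G : Type} (R : Presentation G)

instance : NormedRing (CStar R) := inferInstanceAs (NormedRing (Completion (PolyAlg R)))
instance : CompleteSpace (CStar R) := inferInstanceAs (CompleteSpace (Completion (PolyAlg R)))
instance : Algebra ℂ (CStar R) := inferInstanceAs (Algebra ℂ (Completion (PolyAlg R)))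
instance : NormedAlgebra ℂ (CStar R) where
  norm_smul_le c x := by
    have h : ∀ y : Completion (PolyAlg R), ‖c • y‖ ≤ ‖c‖ * ‖y‖ := fun y => norm_smul_le c y
    exact h x

/-- The inclusion of the dense `*`-subalgebra. -/
def incl (a : PolyAlg R) : CStar R := ((a : Completion (PolyAlg R)))

theorem incl_add (a b : PolyAlg R) : incl R (a + b) = incl R a + incl R b :=
  Completion.coe_add a b
theorem incl_mul (a b : PolyAlg R) : incl R (a * b) = incl R a * incl R b :=
  Completion.coe_mul a b
theorem incl_smul (c : ℂ) (a : PolyAlg R) : incl R (c • a) = c • incl R a :=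
  Completion.coe_smul c a
theorem norm_incl (a : PolyAlg R) : ‖incl R a‖ = ‖a‖ := Completion.norm_coe a
theorem denseRange_incl : DenseRange (incl R) := Completion.denseRange_coe

instance : Star (CStar R) where
  star := Completion.map (star : PolyAlg R → PolyAlg R)

theorem continuous_star' : Continuous (star : CStar R → CStar R) :=
  (Completion.continuous_map : Continuous (Completion.map (star : PolyAlg R → PolyAlg R)))

theorem incl_star (a : PolyAlg R) : incl R (star a) = star (incl R a) :=
  (Completion.map_coe (starₗᵢ ℂ : PolyAlg R ≃ₗᵢ⋆[ℂ] PolyAlg R).isometry.uniformContinuous a).symm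

instance : StarRing (CStar R) where
  star_involutive x := by
    refine (denseRange_incl R).induction_on (p := fun x => star (star x) = x) x
      (isClosed_eq ((continuous_star' R).comp (continuous_star' R)) continuous_id) fun a => ?_
    rw [← incl_star, ← incl_star, star_star]
  star_mul x y := by
    refine (denseRange_incl R).induction_on₂ (p := fun x y => star (x * y) = star y * star x)
      (isClosed_eq ((continuous_star' R).comp continuous_mul)
        (((continuous_star' R).comp continuous_snd).mul
          ((continuous_star' R).comp continuous_fst))) (fun a b => ?_) x y
    rw [← incl_mul, ← incl_star, star_mul, incl_mul, incl_star, incl_star]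
  star_add x y := by
    refine (denseRange_incl R).induction_on₂ (p := fun x y => star (x + y) = star x + star y)
      (isClosed_eq ((continuous_star' R).comp continuous_add)
        (((continuous_star' R).comp continuous_fst).add
          ((continuous_star' R).comp continuous_snd))) (fun a b => ?_) x y
    rw [← incl_add, ← incl_star, star_add, incl_add, incl_star, incl_star]

instance : StarModule ℂ (CStar R) where
  star_smul c x := by
    refine (denseRange_incl R).induction_on (p := fun x => star (c • x) = star c • star x) x
      (isClosed_eq ((continuous_star' R).comp (continuous_const_smul c))
        ((continuous_star' R).const_smul (star c))) fun a => ?_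
    rw [← incl_smul, ← incl_star, star_smul, incl_smul, incl_star]

instance : CStarRing (CStar R) where
  norm_mul_self_le x := by
    refine (denseRange_incl R).induction_on (p := fun x => ‖x‖ * ‖x‖ ≤ ‖star x * x‖) x
      (isClosed_le (continuous_norm.mul continuous_norm)
        (continuous_norm.comp ((continuous_star' R).mul continuous_id))) fun a => ?_
    rw [← incl_star, ← incl_mul, norm_incl, norm_incl, CStarRing.norm_star_mul_self]

instance : CStarAlgebra (CStar R) where

/-- The generators. -/
def gen (g : G) : CStar R := incl R (PolyAlg.gen R g)

end CStar

/-! ### Graph `C^*`-algebras -/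

/-- Row-finite directed graphs: every vertex emits only finitely many edges. -/
structure RowFiniteGraph where
  Vert : Type
  Edge : Type
  src : Edge → Vert
  rng : Edge → Vert
  rowFinite : ∀ v, {e | src e = v}.Finite

/-- A Cuntz-Krieger `E`-family on a Hilbert space: `P v` are mutually orthogonal projections,
`S e` are partial isometries with `(S e)^* (S e) = P (r e)`, and
`P v = ∑_{s e = v} (S e) (S e)^*` unless `v` is a sink. -/
structure IsCuntzKrieger (E : RowFiniteGraph) {H : Type} [NormedAddCommGroup H]
    [InnerProductSpace ℂ H] [CompleteSpace H]
    (P : E.Vert → H →L[ℂ] H) (S : E.Edge → H →L[ℂ] H) : Prop where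
  proj : ∀ v, IsStarProjection (P v)
  orthogonal : ∀ v w, v ≠ w → P v * P w = 0
  initial : ∀ e, star (S e) * S e = P (E.rng e)
  sum_range : ∀ v, (∃ e, E.src e = v) →
    P v = ∑ e ∈ (E.rowFinite v).toFinset, S e * star (S e)

/-- Generators `P v` (`inl v`) and `S e` (`inr e`), subject to the Cuntz-Krieger relations. -/
def cuntzKrieger (E : RowFiniteGraph) : Presentation (E.Vert ⊕ E.Edge) where
  Rel H _ _ _ T := IsCuntzKrieger E (fun v => T (Sum.inl v)) (fun e => T (Sum.inr e))
  bounded g := by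
    refine ⟨1, fun H _ _ _ T h => ?_⟩
    cases g with
    | inl v => exact (h.proj v).norm_le
    | inr e =>
      have h1 : ‖T (Sum.inr e)‖ * ‖T (Sum.inr e)‖ ≤ 1 := by
        rw [← CStarRing.norm_star_mul_self, h.initial e]
        exact (h.proj _).norm_le
      nlinarith [norm_nonneg (T (Sum.inr e))]

/-- The graph `C^*`-algebra `C^*(E)`: the (in general non-unital) `C^*`-algebra generated by the
universal Cuntz-Krieger `E`-family. Representations of the free unital `*`-algebra on `P v`, `S e`
in which these form a Cuntz-Krieger family are the same as Cuntz-Krieger families on Hilbert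
spaces. The family need not act non-degenerately, so the unit of the free algebra does not belong
to `C^*(E)`, which is the closed `*`-subalgebra generated by `P v` and `S e` without the unit. -/
def graphSubalgebra (E : RowFiniteGraph) : NonUnitalStarSubalgebra ℂ (CStar (cuntzKrieger E)) :=
  (NonUnitalStarAlgebra.adjoin ℂ (Set.range (CStar.gen (cuntzKrieger E)))).topologicalClosure

instance (E : RowFiniteGraph) :
    IsClosed (graphSubalgebra E : Set (CStar (cuntzKrieger E))) :=
  NonUnitalStarSubalgebra.isClosed_topologicalClosure _

/-- The graph `C^*`-algebra `C^*(E)`, as a type. -/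
abbrev GraphCStar (E : RowFiniteGraph) : Type := graphSubalgebra E

namespace GraphCStar

variable (E : RowFiniteGraph)

theorem gen_mem (g : E.Vert ⊕ E.Edge) : CStar.gen (cuntzKrieger E) g ∈ graphSubalgebra E :=
  NonUnitalStarSubalgebra.le_topologicalClosure _
    (NonUnitalStarAlgebra.subset_adjoin ℂ _ (Set.mem_range_self g))

/-- The projections `P_v`. -/
def P (v : E.Vert) : GraphCStar E := ⟨CStar.gen (cuntzKrieger E) (Sum.inl v), gen_mem E _⟩

/-- The partial isometries `S_e`. -/
def S (e : E.Edge) : GraphCStar E := ⟨CStar.gen (cuntzKrieger E) (Sum.inr e), gen_mem E _⟩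

end GraphCStar

/-! ### The graph of the quantum 4-ball -/

inductive Vert2 | u | v | w
  deriving DecidableEq

inductive Edge2 | a | b | c | d | e
  deriving DecidableEq

instance : Fintype Edge2 := ⟨{.a, .b, .c, .d, .e}, by rintro ⟨⟩ <;> decide⟩

/-- The graph `E₂`: a loop `a` at `u`, a loop `b` at `v`, edges `c : u → v`, `d : u → w` and
`e : v → w`. -/
abbrev E2 : RowFiniteGraph where
  Vert := Vert2
  Edge := Edge2
  src
    | .a => .u
    | .b => .v
    | .c => .u
    | .d => .u
    | .e => .v
  rng
    | .a => .u
    | .b => .v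
    | .c => .v
    | .d => .w
    | .e => .w
  rowFinite _ := Set.toFinite _

/-- The `C^*`-algebra `C(B_q^4)` of the quantum 4-ball. -/
abbrev QuantumBall4 : Type := GraphCStar E2

/-- `S₁ = S_b + S_e`. -/
def S1 : QuantumBall4 := GraphCStar.S E2 Edge2.b + GraphCStar.S E2 Edge2.e

/-- `S₂ = S_a + S_c + S_d`. -/
def S2 : QuantumBall4 :=
  GraphCStar.S E2 Edge2.a + GraphCStar.S E2 Edge2.c + GraphCStar.S E2 Edge2.d

/-- `S^{k+1} (S^*)^k`, in an algebra that need not have a unit. -/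
def shiftTerm {A : Type*} [Mul A] [Star A] (S : A) : ℕ → A
  | 0 => S
  | k + 1 => S * shiftTerm S k * star S

theorem shiftTerm_eq {A : Type*} [Monoid A] [StarMul A] (S : A) (k : ℕ) :
    shiftTerm S k = S ^ (k + 1) * star S ^ k := by
  induction k with
  | zero => simp [shiftTerm]
  | succ k ih => rw [shiftTerm, ih, pow_succ' S (k + 1), pow_succ (star S) k]; simp [mul_assoc]

/-- `λ_k = √(1 - q^{k+1}) - √(1 - q^k)`. -/
def weight (q : ℝ) (k : ℕ) : ℝ := Real.sqrt (1 - q ^ (k + 1)) - Real.sqrt (1 - q ^ k)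

/-! ### The polynomial algebra of the quantum 4-ball -/

/-- The relations between `x₁` and `x₂`. The third one makes `x₂^* x₂` invertible, and
`|x₂|^{-2}` is the inverse of `|x₂|^2 = x₂^* x₂`. -/
structure BallRel (q : ℝ) {H : Type} [NormedAddCommGroup H] [InnerProductSpace ℂ H]
    [CompleteSpace H] (x₁ x₂ : H →L[ℂ] H) : Prop where
  mul_eq_zero : x₁ * x₂ = 0
  star_mul_eq_zero : star x₁ * x₂ = 0
  rel₂ : star x₂ * x₂ - (q : ℂ) • (x₂ * star x₂) = ((1 - q : ℝ) : ℂ) • 1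
  rel₁ : star x₁ * x₁ - (q : ℂ) • (x₁ * star x₁)
    = ((1 - q : ℝ) : ℂ) • (1 - x₂ * Ring.inverse (star x₂ * x₂) * star x₂)

section Bounds

open scoped ComplexOrder

variable {H : Type} [NormedAddCommGroup H] [InnerProductSpace ℂ H] [CompleteSpace H]

theorem norm_le_one_of_rel {q : ℝ} (hq0 : 0 ≤ q) (hq1 : q < 1) {x p : H →L[ℂ] H}
    (hp : ‖p‖ ≤ 1)
    (h : star x * x - (q : ℂ) • (x * star x) = ((1 - q : ℝ) : ℂ) • p) : ‖x‖ ≤ 1 := by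
  have h1 : star x * x = (q : ℂ) • (x * star x) + ((1 - q : ℝ) : ℂ) • p := by
    rw [← h]; abel
  have h2 : ‖x‖ * ‖x‖ ≤ q * (‖x‖ * ‖x‖) + (1 - q) * 1 := by
    rw [← CStarRing.norm_star_mul_self, h1]
    refine (norm_add_le _ _).trans (add_le_add ?_ ?_)
    · rw [norm_smul, CStarRing.norm_self_mul_star, ← h1, CStarRing.norm_star_mul_self,
        Complex.norm_real, Real.norm_of_nonneg hq0]
    · rw [norm_smul, Complex.norm_real, Real.norm_of_nonneg (by linarith)]
      exact mul_le_mul_of_nonneg_left hp (by linarith)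
  have h3 : (1 - q) * (‖x‖ * ‖x‖) ≤ (1 - q) * 1 := by linarith
  have h4 := le_of_mul_le_mul_left h3 (by linarith)
  nlinarith [norm_nonneg x]

theorem isUnit_of_rel {q : ℝ} (hq0 : 0 ≤ q) (hq1 : q < 1) {x : H →L[ℂ] H}
    (h : star x * x - (q : ℂ) • (x * star x) = ((1 - q : ℝ) : ℂ) • 1) :
    IsUnit (star x * x) := by
  have h1 : star x * x = (q : ℂ) • (x * star x) + ((1 - q : ℝ) : ℂ) • 1 := by
    rw [← h]; abel
  have h2 : (0 : H →L[ℂ] H) ≤ (q : ℂ) • (x * star x) :=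
    smul_nonneg (by exact_mod_cast hq0) (mul_star_self_nonneg x)
  have h3 : algebraMap ℝ (H →L[ℂ] H) (1 - q) ≤ star x * x := by
    rw [h1, Algebra.algebraMap_eq_smul_one]
    have : ((1 - q : ℝ) : ℂ) • (1 : H →L[ℂ] H) = (1 - q) • 1 := by
      rw [Complex.coe_smul]
    rw [this]
    exact le_add_of_nonneg_left h2
  exact CStarAlgebra.isUnit_of_le (algebraMap ℝ (H →L[ℂ] H) (1 - q)) h3
    (isStrictlyPositive_algebraMap (by linarith))

theorem isStarProjection_of_isUnit {x : H →L[ℂ] H} (h : IsUnit (star x * x)) :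
    IsStarProjection (1 - x * Ring.inverse (star x * x) * star x) := by
  refine IsStarProjection.one_sub ⟨?_, ?_⟩
  · have h1 := Ring.inverse_mul_cancel _ h
    calc x * Ring.inverse (star x * x) * star x * (x * Ring.inverse (star x * x) * star x)
        = x * (Ring.inverse (star x * x) * (star x * x)) * Ring.inverse (star x * x) * star x := by
          simp only [mul_assoc]
      _ = x * Ring.inverse (star x * x) * star x := by rw [h1, mul_one]
  · have h2 : star (Ring.inverse (star x * x)) = Ring.inverse (star x * x) := by
      rw [← Ring.inverse_star, star_mul, star_star]
    rw [isSelfAdjoint_iff, star_mul, star_mul, star_star, h2, mul_assoc]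

end Bounds

/-- Generators `x₁` (`0`) and `x₂` (`1`), subject to the relations `BallRel`. -/
def ballPresentation (q : ℝ) (hq0 : 0 < q) (hq1 : q < 1) : Presentation (Fin 2) where
  Rel H _ _ _ x := BallRel q (x 0) (x 1)
  bounded g := by
    refine ⟨1, fun H _ _ _ x h => ?_⟩
    fin_cases g
    · exact norm_le_one_of_rel hq0.le hq1
        (isStarProjection_of_isUnit (isUnit_of_rel hq0.le hq1 h.rel₂)).norm_le h.rel₁
    · refine norm_le_one_of_rel hq0.le hq1 ?_ h.rel₂
      exact ContinuousLinearMap.norm_id_le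

/-- The polynomial algebra `P(B_q^4)`, with its norm. -/
abbrev PolyBall4 (q : ℝ) (hq0 : 0 < q) (hq1 : q < 1) : Type :=
  PolyAlg (ballPresentation q hq0 hq1)

/-- The completion `C^*(x₁, x₂)` of `P(B_q^4)`. -/
abbrev CStarBall4 (q : ℝ) (hq0 : 0 < q) (hq1 : q < 1) : Type :=
  CStar (ballPresentation q hq0 hq1)

/-- The generator `x₁` of `C^*(x₁, x₂)`. -/
def x1 (q : ℝ) (hq0 : 0 < q) (hq1 : q < 1) : CStarBall4 q hq0 hq1 := CStar.gen _ 0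

/-- The generator `x₂` of `C^*(x₁, x₂)`. -/
def x2 (q : ℝ) (hq0 : 0 < q) (hq1 : q < 1) : CStarBall4 q hq0 hq1 := CStar.gen _ 1

end QBall

end

noncomputable section

namespace QBall

section Isometry

variable {A : Type*} [CStarAlgebra A]

theorem weight_nonneg {q : ℝ} (hq0 : 0 ≤ q) (hq1 : q ≤ 1) (k : ℕ) : 0 ≤ weight q k :=
  sub_nonneg.2 <| Real.sqrt_le_sqrt <|
    sub_le_sub_left (pow_le_pow_of_le_one hq0 hq1 k.le_succ) _

theorem sum_weight (q : ℝ) (n : ℕ) :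
    ∑ k ∈ Finset.range n, weight q k = Real.sqrt (1 - q ^ n) := by
  simp only [weight]
  rw [Finset.sum_range_sub (fun k => Real.sqrt (1 - q ^ k))]
  simp

theorem hasSum_weight {q : ℝ} (hq0 : 0 ≤ q) (hq1 : q < 1) : HasSum (weight q) 1 := by
  rw [hasSum_iff_tendsto_nat_of_nonneg (weight_nonneg hq0 hq1.le)]
  simp only [sum_weight]
  have h := ((tendsto_pow_atTop_nhds_zero_of_lt_one hq0 hq1).const_sub 1).sqrt
  simpa using h

/-- `∑ λ_k S^{k+1} (S^*)^k`. -/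
def weightSum (q : ℝ) (s : A) : A := ∑' k, (weight q k : ℂ) • shiftTerm s k

theorem norm_shiftTerm_le {B : Type*} [NonUnitalNormedRing B] [StarRing B] [CStarRing B]
    {s : B} (hs : ‖s‖ ≤ 1) (k : ℕ) : ‖shiftTerm s k‖ ≤ 1 := by
  induction k with
  | zero => exact hs
  | succ k ih =>
    refine (norm_mul_le _ _).trans (mul_le_one₀ ?_ (norm_nonneg _) (by rwa [norm_star]))
    exact (norm_mul_le _ _).trans (mul_le_one₀ hs (norm_nonneg _) ih)

theorem summable_weight_smul {q : ℝ} (hq0 : 0 ≤ q) (hq1 : q < 1) {f : ℕ → A}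
    (hf : ∀ k, ‖f k‖ ≤ 1) : Summable fun k => (weight q k : ℂ) • f k := by
  refine Summable.of_norm_bounded (hasSum_weight hq0 hq1).summable fun k => ?_
  rw [norm_smul, Complex.norm_real, Real.norm_of_nonneg (weight_nonneg hq0 hq1.le k)]
  exact mul_le_of_le_one_right (weight_nonneg hq0 hq1.le k) (hf k)

theorem hasSum_weightSum {q : ℝ} (hq0 : 0 ≤ q) (hq1 : q < 1) {s : A} (hs : ‖s‖ ≤ 1) :
    HasSum (fun k => (weight q k : ℂ) • shiftTerm s k) (weightSum q s) :=
  (summable_weight_smul hq0 hq1 (norm_shiftTerm_le hs)).hasSum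

theorem map_shiftTerm {B C F : Type*} [Mul B] [Star B] [Mul C] [Star C] [FunLike F B C]
    [MulHomClass F B C] [StarHomClass F B C] (f : F) (s : B) (k : ℕ) :
    f (shiftTerm s k) = shiftTerm (f s) k := by
  induction k with
  | zero => rfl
  | succ k ih => rw [shiftTerm, map_mul, map_mul, ih, map_star, shiftTerm]

open scoped CStarAlgebra in
theorem map_weightSum {B : Type*} [CStarAlgebra B] {q : ℝ} (hq0 : 0 ≤ q) (hq1 : q < 1)
    (f : A →⋆ₐ[ℂ] B) {s : A} (hs : ‖s‖ ≤ 1) : f (weightSum q s) = weightSum q (f s) := by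
  have h := (hasSum_weightSum hq0 hq1 hs).map f (map_continuous f)
  refine (h.tsum_eq.symm.trans ?_)
  simp only [weightSum, Function.comp_def, map_smul, map_shiftTerm]

theorem norm_le_one_of_star_mul_self {s p : A} (hp : IsStarProjection p) (hs : star s * s = p) :
    ‖s‖ ≤ 1 := by
  have h := hp.norm_le
  rw [← hs, CStarRing.norm_star_mul_self] at h
  nlinarith [norm_nonneg s]

theorem norm_le_one_of_isometry {s : A} (hs : star s * s = 1) : ‖s‖ ≤ 1 :=
  norm_le_one_of_star_mul_self (IsStarProjection.one A) hs

/-- `S^k (S^*)^k`. -/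
def rangeProj (s : A) (k : ℕ) : A := s ^ k * star s ^ k

theorem star_pow_mul_pow {s : A} (hs : star s * s = 1) (n : ℕ) : star s ^ n * s ^ n = 1 := by
  induction n with
  | zero => simp
  | succ n ih =>
    rw [pow_succ, pow_succ', mul_assoc, ← mul_assoc (star s) s, hs, one_mul, ih]

theorem rangeProj_succ (s : A) (n : ℕ) : rangeProj s (n + 1) = s * rangeProj s n * star s := by
  rw [rangeProj, rangeProj, pow_succ', pow_succ]; simp only [mul_assoc]

theorem star_rangeProj (s : A) (n : ℕ) : star (rangeProj s n) = rangeProj s n := by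
  simp [rangeProj]

theorem rangeProj_mul_rangeProj {s : A} (hs : star s * s = 1) {i n : ℕ} (h : i ≤ n) :
    rangeProj s i * rangeProj s n = rangeProj s n := by
  obtain ⟨m, rfl⟩ := Nat.exists_eq_add_of_le h
  simp only [rangeProj]
  rw [pow_add s, mul_assoc, mul_assoc (s ^ i) (s ^ m), ← mul_assoc (star s ^ i),
    star_pow_mul_pow hs, one_mul]

theorem rangeProj_mul_rangeProj' {s : A} (hs : star s * s = 1) {i n : ℕ} (h : i ≤ n) :
    rangeProj s n * rangeProj s i = rangeProj s n := by
  have := congrArg star (rangeProj_mul_rangeProj hs h)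
  rwa [star_mul, star_rangeProj, star_rangeProj] at this

theorem isStarProjection_rangeProj {s : A} (hs : star s * s = 1) (n : ℕ) :
    IsStarProjection (rangeProj s n) :=
  ⟨rangeProj_mul_rangeProj hs le_rfl, star_rangeProj s n⟩

theorem shiftTerm_eq_mul_rangeProj (s : A) (k : ℕ) : shiftTerm s k = s * rangeProj s k := by
  rw [shiftTerm_eq, rangeProj, pow_succ', mul_assoc]

/-- The modulus `∑ λ_k S^k (S^*)^k` of `weightSum q s`. -/
def modulus (q : ℝ) (s : A) : A := ∑' k, (weight q k : ℂ) • rangeProj s k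

/-- The partial sums of `modulus q s`. -/
def partialModulus (q : ℝ) (s : A) (n : ℕ) : A :=
  ∑ k ∈ Finset.range n, (weight q k : ℂ) • rangeProj s k

theorem hasSum_modulus {q : ℝ} (hq0 : 0 ≤ q) (hq1 : q < 1) {s : A} (hs : star s * s = 1) :
    HasSum (fun k => (weight q k : ℂ) • rangeProj s k) (modulus q s) :=
  (summable_weight_smul hq0 hq1 fun k => (isStarProjection_rangeProj hs k).norm_le).hasSum

theorem weightSum_eq_mul_modulus {q : ℝ} (hq0 : 0 ≤ q) (hq1 : q < 1) {s : A}
    (hs : star s * s = 1) : weightSum q s = s * modulus q s := by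
  rw [← ((hasSum_modulus hq0 hq1 hs).mul_left s).tsum_eq, weightSum]
  simp only [shiftTerm_eq_mul_rangeProj, mul_smul_comm]

theorem star_modulus {q : ℝ} (hq0 : 0 ≤ q) (hq1 : q < 1) {s : A} (hs : star s * s = 1) :
    star (modulus q s) = modulus q s := by
  have h := (hasSum_modulus hq0 hq1 hs).star
  simp only [star_smul, star_rangeProj, Complex.star_def, Complex.conj_ofReal] at h
  exact h.unique (hasSum_modulus hq0 hq1 hs)

theorem modulus_nonneg [PartialOrder A] [StarOrderedRing A] {q : ℝ} (hq0 : 0 ≤ q) (hq1 : q < 1)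
    {s : A} (hs : star s * s = 1) : 0 ≤ modulus q s := by
  refine (hasSum_modulus hq0 hq1 hs).nonneg fun k => ?_
  rw [Complex.coe_smul]
  exact smul_nonneg (weight_nonneg hq0 hq1.le k) (isStarProjection_rangeProj hs k).nonneg

theorem partialModulus_mul_rangeProj (q : ℝ) {s : A} (hs : star s * s = 1) (n : ℕ) :
    partialModulus q s n * rangeProj s n = (Real.sqrt (1 - q ^ n) : ℂ) • rangeProj s n := by
  rw [partialModulus, Finset.sum_mul, ← sum_weight, Complex.ofReal_sum, Finset.sum_smul]
  refine Finset.sum_congr rfl fun k hk => ?_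
  rw [smul_mul_assoc, rangeProj_mul_rangeProj hs (Finset.mem_range.1 hk).le]

theorem rangeProj_mul_partialModulus (q : ℝ) {s : A} (hs : star s * s = 1) (n : ℕ) :
    rangeProj s n * partialModulus q s n = (Real.sqrt (1 - q ^ n) : ℂ) • rangeProj s n := by
  rw [partialModulus, Finset.mul_sum, ← sum_weight, Complex.ofReal_sum, Finset.sum_smul]
  refine Finset.sum_congr rfl fun k hk => ?_
  rw [mul_smul_comm, rangeProj_mul_rangeProj' hs (Finset.mem_range.1 hk).le]

theorem weight_identity {q : ℝ} (hq0 : 0 ≤ q) (hq1 : q < 1) (n : ℕ) :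
    weight q n * Real.sqrt (1 - q ^ n) + weight q n * Real.sqrt (1 - q ^ n)
      + weight q n * weight q n = (1 - q) * q ^ n := by
  have h1 := Real.mul_self_sqrt (sub_nonneg.2 (pow_le_one₀ (n := n) hq0 hq1.le))
  have h2 := Real.mul_self_sqrt (sub_nonneg.2 (pow_le_one₀ (n := n + 1) hq0 hq1.le))
  rw [weight]
  linear_combination h2 - h1

theorem partialModulus_mul_self {q : ℝ} (hq0 : 0 ≤ q) (hq1 : q < 1) {s : A}
    (hs : star s * s = 1) (n : ℕ) : partialModulus q s n * partialModulus q s n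
      = ∑ k ∈ Finset.range n, (((1 - q) * q ^ k : ℝ) : ℂ) • rangeProj s k := by
  induction n with
  | zero => simp [partialModulus]
  | succ n ih =>
    rw [Finset.sum_range_succ, ← ih, ← weight_identity hq0 hq1]
    have h : partialModulus q s (n + 1)
      = partialModulus q s n + (weight q n : ℂ) • rangeProj s n := Finset.sum_range_succ _ _
    rw [h, mul_add, add_mul, add_mul, smul_mul_assoc, mul_smul_comm, smul_mul_assoc,
      mul_smul_comm, partialModulus_mul_rangeProj q hs, rangeProj_mul_partialModulus q hs,
      rangeProj_mul_rangeProj hs le_rfl]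
    push_cast
    module

theorem partialModulus_rel {q : ℝ} (hq0 : 0 ≤ q) (hq1 : q < 1) {s : A}
    (hs : star s * s = 1) (n : ℕ) : partialModulus q s n * partialModulus q s n
      - (q : ℂ) • (s * (partialModulus q s n * partialModulus q s n) * star s)
      = ((1 - q : ℝ) : ℂ) • 1 - (((1 - q) * q ^ n : ℝ) : ℂ) • rangeProj s n := by
  rw [partialModulus_mul_self hq0 hq1 hs]
  induction n with
  | zero => simp [rangeProj]
  | succ n ih =>
    rw [Finset.sum_range_succ, mul_add, add_mul, mul_smul_comm, smul_mul_assoc, ← rangeProj_succ,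
      smul_add, add_sub_add_comm, ih]
    push_cast
    module

theorem modulus_rel {q : ℝ} (hq0 : 0 ≤ q) (hq1 : q < 1) {s : A} (hs : star s * s = 1) :
    modulus q s * modulus q s - (q : ℂ) • (s * (modulus q s * modulus q s) * star s)
      = ((1 - q : ℝ) : ℂ) • 1 := by
  have h1 := (hasSum_modulus hq0 hq1 hs).tendsto_sum_nat
  have h2 := h1.mul h1
  have h3 := h2.sub (((h2.const_mul s).mul_const (star s)).const_smul (q : ℂ))
  refine tendsto_nhds_unique h3 ?_
  have h4 : Filter.Tendsto (fun n : ℕ => (((1 - q) * q ^ n : ℝ) : ℂ) • rangeProj s n)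
      Filter.atTop (nhds 0) := by
    refine squeeze_zero_norm (a := fun n => (1 - q) * q ^ n) (fun n => ?_) ?_
    · rw [norm_smul, Complex.norm_real, Real.norm_of_nonneg
        (mul_nonneg (by linarith) (pow_nonneg hq0 n))]
      exact mul_le_of_le_one_right (mul_nonneg (by linarith) (pow_nonneg hq0 n))
        (isStarProjection_rangeProj hs n).norm_le
    · simpa using (tendsto_pow_atTop_nhds_zero_of_lt_one hq0 hq1).const_mul (1 - q)
  have h5 := h4.const_sub (((1 - q : ℝ) : ℂ) • (1 : A))
  rw [sub_zero] at h5
  exact h5.congr fun n => (partialModulus_rel hq0 hq1 hs n).symm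

theorem eq_of_rel {q : ℝ} (hq0 : 0 ≤ q) (hq1 : q < 1) {s a b c : A} (hs : ‖s‖ ≤ 1)
    (ha : a - (q : ℂ) • (s * a * star s) = c) (hb : b - (q : ℂ) • (s * b * star s) = c) :
    a = b := by
  have h1 : a - b = (q : ℂ) • (s * (a - b) * star s) := by
    rw [mul_sub, sub_mul, smul_sub]
    exact sub_eq_sub_iff_sub_eq_sub.1 (ha.trans hb.symm)
  have h2 : ‖a - b‖ ≤ q * ‖a - b‖ := by
    conv_lhs => rw [h1]
    rw [norm_smul, Complex.norm_real, Real.norm_of_nonneg hq0]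
    refine mul_le_mul_of_nonneg_left ?_ hq0
    refine (norm_mul_le _ _).trans ?_
    refine (mul_le_of_le_one_right (norm_nonneg _) (by rwa [norm_star])).trans ?_
    exact (norm_mul_le _ _).trans (mul_le_of_le_one_left (norm_nonneg _) hs)
  have h3 : ‖a - b‖ = 0 := by nlinarith [norm_nonneg (a - b)]
  exact sub_eq_zero.1 (norm_eq_zero.1 h3)

theorem star_weightSum_mul_weightSum {q : ℝ} (hq0 : 0 ≤ q) (hq1 : q < 1) {s : A}
    (hs : star s * s = 1) :
    star (weightSum q s) * weightSum q s = modulus q s * modulus q s := by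
  rw [weightSum_eq_mul_modulus hq0 hq1 hs, star_mul, star_modulus hq0 hq1 hs, mul_assoc,
    ← mul_assoc (star s), hs, one_mul]

theorem weightSum_rel {q : ℝ} (hq0 : 0 ≤ q) (hq1 : q < 1) {s : A} (hs : star s * s = 1) :
    star (weightSum q s) * weightSum q s - (q : ℂ) • (weightSum q s * star (weightSum q s))
      = ((1 - q : ℝ) : ℂ) • 1 := by
  rw [star_weightSum_mul_weightSum hq0 hq1 hs, ← modulus_rel hq0 hq1 hs]
  conv_lhs => rw [weightSum_eq_mul_modulus hq0 hq1 hs, star_mul, star_modulus hq0 hq1 hs]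
  simp only [mul_assoc]

open scoped ComplexOrder in
theorem isStrictlyPositive_of_rel [PartialOrder A] [StarOrderedRing A] {q : ℝ} (hq0 : 0 ≤ q)
    (hq1 : q < 1) {x : A}
    (h : star x * x - (q : ℂ) • (x * star x) = ((1 - q : ℝ) : ℂ) • 1) :
    IsStrictlyPositive (star x * x) := by
  have h1 : star x * x = (q : ℂ) • (x * star x) + ((1 - q : ℝ) : ℂ) • 1 := by
    rw [← h]; abel
  have h2 : (0 : A) ≤ (q : ℂ) • (x * star x) :=
    smul_nonneg (by exact_mod_cast hq0) (mul_star_self_nonneg x)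
  have h3 : algebraMap ℝ A (1 - q) ≤ star x * x := by
    rw [h1, Algebra.algebraMap_eq_smul_one, Complex.coe_smul]
    exact le_add_of_nonneg_left h2
  exact ⟨star_mul_self_nonneg x, CStarAlgebra.isUnit_of_le (algebraMap ℝ A (1 - q)) h3
    (isStrictlyPositive_algebraMap (by linarith))⟩

theorem modulus_eq_sqrt [PartialOrder A] [StarOrderedRing A] {q : ℝ} (hq0 : 0 ≤ q) (hq1 : q < 1)
    {s : A} (hs : star s * s = 1) :
    modulus q s = CFC.sqrt (star (weightSum q s) * weightSum q s) :=
  (CFC.sqrt_unique (star_weightSum_mul_weightSum hq0 hq1 hs).symm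
    (modulus_nonneg hq0 hq1 hs)).symm

theorem isUnit_modulus {q : ℝ} (hq0 : 0 ≤ q) (hq1 : q < 1) {s : A} (hs : star s * s = 1) :
    IsUnit (modulus q s) := by
  let _ := CStarAlgebra.spectralOrder A
  have _ := CStarAlgebra.spectralOrderedRing A
  rw [modulus_eq_sqrt hq0 hq1 hs, CFC.isUnit_sqrt_iff _ (star_mul_self_nonneg _)]
  exact (isStrictlyPositive_of_rel hq0 hq1 (weightSum_rel hq0 hq1 hs)).isUnit

/-- An isometry is determined by its weighted sum. -/
theorem eq_of_weightSum_eq {q : ℝ} (hq0 : 0 ≤ q) (hq1 : q < 1) {s t : A} (hs : star s * s = 1)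
    (ht : star t * t = 1) (h : weightSum q s = weightSum q t) : s = t := by
  have hm : modulus q s = modulus q t := by
    let _ := CStarAlgebra.spectralOrder A
    have _ := CStarAlgebra.spectralOrderedRing A
    rw [modulus_eq_sqrt hq0 hq1 hs, h, modulus_eq_sqrt hq0 hq1 ht]
  rw [weightSum_eq_mul_modulus hq0 hq1 hs, weightSum_eq_mul_modulus hq0 hq1 ht, hm] at h
  exact (isUnit_modulus hq0 hq1 ht).mul_right_cancel h

/-- The polar part of a solution of the `q`-disc relation. -/
theorem exists_isometry_of_rel {q : ℝ} (hq0 : 0 ≤ q) (hq1 : q < 1) {x : A}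
    (h : star x * x - (q : ℂ) • (x * star x) = ((1 - q : ℝ) : ℂ) • 1) :
    ∃ s : A, star s * s = 1 ∧ weightSum q s = x := by
  let _ := CStarAlgebra.spectralOrder A
  have _ := CStarAlgebra.spectralOrderedRing A
  have hpos := isStrictlyPositive_of_rel hq0 hq1 h
  obtain ⟨u, hu⟩ := (CFC.isUnit_sqrt_iff _ hpos.nonneg).2 hpos.isUnit
  have hu0 : (0 : A) ≤ u := hu ▸ CFC.sqrt_nonneg _
  have hsa : star (u : A) = u := hu0.isSelfAdjoint
  have husa : star u = u := Units.ext hsa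
  have hsq : (u : A) * u = star x * x := by rw [hu]; exact CFC.sqrt_mul_sqrt_self _ hpos.nonneg
  have hsinv : star ((u⁻¹ : Aˣ) : A) = (u⁻¹ : Aˣ) := by
    rw [← Units.coe_star, star_inv, husa]
  have hs : star (x * (u⁻¹ : Aˣ)) * (x * (u⁻¹ : Aˣ)) = 1 := by
    rw [star_mul, hsinv, mul_assoc, ← mul_assoc (star x), ← hsq]
    simp
  have hx : x = x * (u⁻¹ : Aˣ) * u := by simp
  set s := x * (u⁻¹ : Aˣ) with hsdef
  refine ⟨s, hs, ?_⟩
  have hrel : (u : A) * u - (q : ℂ) • (s * ((u : A) * u) * star s) = ((1 - q : ℝ) : ℂ) • 1 := by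
    rw [← h, hsq]
    congr 2
    rw [← hsq]
    conv_rhs => rw [hx, star_mul, hsa]
    simp only [mul_assoc]
  have hmm := eq_of_rel hq0 hq1 (norm_le_one_of_isometry hs) (modulus_rel hq0 hq1 hs) hrel
  have hmu : modulus q s = u := by
    rw [← CFC.sqrt_mul_self _ (modulus_nonneg hq0 hq1 hs), hmm, CFC.sqrt_mul_self _ hu0]
  rw [weightSum_eq_mul_modulus hq0 hq1 hs, hmu, ← hx]

end Isometry

section Pairs

variable {A : Type*} [CStarAlgebra A]

theorem commute_shiftTerm {p t : A} (h : Commute p t) (h' : Commute p (star t)) (k : ℕ) :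
    Commute p (shiftTerm t k) := by
  induction k with
  | zero => exact h
  | succ k ih => exact (h.mul_right ih).mul_right h'

theorem shiftTerm_mul_proj {p t : A} (hp : IsStarProjection p) (h : Commute p t)
    (h' : Commute p (star t)) (k : ℕ) : shiftTerm (t * p) k = shiftTerm t k * p := by
  induction k with
  | zero => rfl
  | succ k ih =>
    have hpp : p * p = p := hp.isIdempotentElem
    have hps : star p = p := hp.isSelfAdjoint
    rw [shiftTerm, shiftTerm, ih, star_mul, hps, mul_assoc t p,
      (commute_shiftTerm h h' k).left_comm, hpp, mul_assoc t, mul_assoc (shiftTerm t k),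
      ← mul_assoc p p, hpp, h'.eq]
    simp only [mul_assoc]

theorem weightSum_mul_proj {q : ℝ} (hq0 : 0 ≤ q) (hq1 : q < 1) {p t : A}
    (hp : IsStarProjection p) (ht : ‖t‖ ≤ 1) (h : Commute p t) :
    weightSum q (t * p) = weightSum q t * p := by
  have h' : Commute p (star t) := by
    have := h.star_star
    rwa [hp.isSelfAdjoint.star_eq] at this
  rw [← ((hasSum_weightSum hq0 hq1 ht).mul_right p).tsum_eq, weightSum]
  simp only [shiftTerm_mul_proj hp h h', smul_mul_assoc]

theorem shiftTerm_mul_eq_zero {s y : A} (h : s * y = 0) (h' : star s * y = 0) (k : ℕ) :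
    shiftTerm s k * y = 0 := by
  cases k with
  | zero => exact h
  | succ k => rw [shiftTerm, mul_assoc, h', mul_zero]

theorem mul_shiftTerm_eq_zero {s y : A} (h : y * s = 0) (k : ℕ) : y * shiftTerm s k = 0 := by
  cases k with
  | zero => exact h
  | succ k => rw [shiftTerm, mul_assoc, ← mul_assoc, h, zero_mul]

theorem weightSum_mul_eq_zero {q : ℝ} (hq0 : 0 ≤ q) (hq1 : q < 1) {s y : A} (hs : ‖s‖ ≤ 1)
    (h : s * y = 0) (h' : star s * y = 0) : weightSum q s * y = 0 := by
  rw [← ((hasSum_weightSum hq0 hq1 hs).mul_right y).tsum_eq]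
  simp [shiftTerm_mul_eq_zero h h']

theorem mul_weightSum_eq_zero {q : ℝ} (hq0 : 0 ≤ q) (hq1 : q < 1) {s y : A} (hs : ‖s‖ ≤ 1)
    (h : y * s = 0) : y * weightSum q s = 0 := by
  rw [← ((hasSum_weightSum hq0 hq1 hs).mul_left y).tsum_eq]
  simp [mul_shiftTerm_eq_zero h]

theorem shiftTerm_add_proj {s r : A} (hr : IsStarProjection r) (h : s * r = 0) (h' : r * s = 0)
    (k : ℕ) : shiftTerm (s + r) k = shiftTerm s k + r := by
  have hrr : r * r = r := hr.isIdempotentElem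
  have hrs : star r = r := hr.isSelfAdjoint
  have h1 : r * star s = 0 := by simpa [hrs] using congrArg star h
  have h2 : star s * r = 0 := by simpa [hrs] using congrArg star h'
  induction k with
  | zero => rfl
  | succ k ih =>
    have h3 := mul_shiftTerm_eq_zero h' k
    have h4 := shiftTerm_mul_eq_zero h h2 k
    rw [shiftTerm, shiftTerm, ih, star_add, hrs]
    have e1 : (s + r) * (shiftTerm s k + r) = s * shiftTerm s k + r := by
      rw [add_mul, mul_add, mul_add, h, h3, hrr]; abel
    rw [e1, add_mul, mul_add, mul_add, mul_assoc s _ r, h4, h1, hrr]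
    simp

theorem weightSum_add_proj {q : ℝ} (hq0 : 0 ≤ q) (hq1 : q < 1) {s r : A} (hs : ‖s‖ ≤ 1)
    (hr : IsStarProjection r) (h : s * r = 0) (h' : r * s = 0) :
    weightSum q (s + r) = weightSum q s + r := by
  have h1 : HasSum (fun k => (weight q k : ℂ) • r) r := by
    have := ((Complex.hasSum_ofReal.2 (hasSum_weight hq0 hq1)).smul_const r)
    simpa using this
  rw [← ((hasSum_weightSum hq0 hq1 hs).add h1).tsum_eq, weightSum]
  simp only [shiftTerm_add_proj hr h h', smul_add]

theorem weightSum_conj {q : ℝ} (hq0 : 0 ≤ q) (hq1 : q < 1) {w t : A} (hw : star w * w = 1)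
    (ht : ‖t‖ ≤ 1) : weightSum q (w * t * star w) = w * weightSum q t * star w := by
  have h : ∀ k, shiftTerm (w * t * star w) k = w * shiftTerm t k * star w := by
    intro k
    induction k with
    | zero => rfl
    | succ k ih =>
      rw [shiftTerm, shiftTerm, ih, star_mul, star_mul, star_star]
      simp only [mul_assoc]
      rw [← mul_assoc (star w) w, hw, one_mul, ← mul_assoc (star w) w, hw, one_mul]
  rw [← (((hasSum_weightSum hq0 hq1 ht).mul_left w).mul_right (star w)).tsum_eq, weightSum]
  simp only [h, mul_smul_comm, smul_mul_assoc]

theorem weightSum_mul_inverse {q : ℝ} (hq0 : 0 ≤ q) (hq1 : q < 1) {s : A}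
    (hs : star s * s = 1) :
    weightSum q s * Ring.inverse (star (weightSum q s) * weightSum q s) * star (weightSum q s)
      = s * star s := by
  rw [star_weightSum_mul_weightSum hq0 hq1 hs, weightSum_eq_mul_modulus hq0 hq1 hs, star_mul,
    star_modulus hq0 hq1 hs]
  obtain ⟨u, hu⟩ := isUnit_modulus hq0 hq1 hs
  rw [← hu, ← Units.val_mul, Ring.inverse_unit, mul_inv_rev, Units.val_mul]
  simp only [mul_assoc, Units.mul_inv_cancel_left, Units.inv_mul_cancel_left]

theorem isStarProjection_mul_star {s : A} (hs : star s * s = 1) :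
    IsStarProjection (s * star s) :=
  ⟨by rw [IsIdempotentElem, mul_assoc, ← mul_assoc (star s), hs, one_mul], by simp [IsSelfAdjoint]⟩

/-- `s₂` is an isometry, and `s₁` an isometry of the orthogonal complement of its range. -/
structure IsoPair (s₁ s₂ : A) : Prop where
  iso₂ : star s₂ * s₂ = 1
  iso₁ : star s₁ * s₁ = 1 - s₂ * star s₂
  orth : star s₁ * s₂ = 0

/-- The relations `BallRel` in a `C^*`-algebra. -/
structure BallPair (q : ℝ) (x₁ x₂ : A) : Prop where
  mul_eq_zero : x₁ * x₂ = 0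
  star_mul_eq_zero : star x₁ * x₂ = 0
  rel₂ : star x₂ * x₂ - (q : ℂ) • (x₂ * star x₂) = ((1 - q : ℝ) : ℂ) • 1
  rel₁ : star x₁ * x₁ - (q : ℂ) • (x₁ * star x₁)
    = ((1 - q : ℝ) : ℂ) • (1 - x₂ * Ring.inverse (star x₂ * x₂) * star x₂)

namespace IsoPair

variable {s₁ s₂ : A}

theorem map {B : Type*} [CStarAlgebra B] (h : IsoPair s₁ s₂) (f : A →⋆ₐ[ℂ] B) :
    IsoPair (f s₁) (f s₂) where
  iso₂ := by rw [← map_star, ← map_mul, h.iso₂, map_one]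
  iso₁ := by rw [← map_star, ← map_mul, h.iso₁, map_sub, map_one, map_mul, map_star]
  orth := by rw [← map_star, ← map_mul, h.orth, map_zero]

theorem mul_eq_zero (h : IsoPair s₁ s₂) : s₁ * s₂ = 0 := by
  rw [← CStarRing.star_mul_self_eq_zero_iff, star_mul, mul_assoc, ← mul_assoc (star s₁), h.iso₁,
    sub_mul, mul_assoc s₂, h.iso₂]
  simp

theorem orth' (h : IsoPair s₁ s₂) : star s₂ * s₁ = 0 := by
  simpa using congrArg star h.orth

theorem isStarProjection (h : IsoPair s₁ s₂) : IsStarProjection (s₂ * star s₂) :=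
  isStarProjection_mul_star h.iso₂

theorem norm_le₁ (h : IsoPair s₁ s₂) : ‖s₁‖ ≤ 1 :=
  norm_le_one_of_star_mul_self h.isStarProjection.one_sub h.iso₁

theorem norm_le₂ (h : IsoPair s₁ s₂) : ‖s₂‖ ≤ 1 := norm_le_one_of_isometry h.iso₂

theorem add_isometry (h : IsoPair s₁ s₂) :
    star (s₁ + s₂ * star s₂) * (s₁ + s₂ * star s₂) = 1 := by
  have h1 : s₂ * star s₂ * (s₂ * star s₂) = s₂ * star s₂ := h.isStarProjection.isIdempotentElem
  rw [star_add, h.isStarProjection.isSelfAdjoint.star_eq, add_mul, mul_add, mul_add, h.iso₁, h1,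
    ← mul_assoc (star s₁), h.orth, mul_assoc s₂ _ s₁, h.orth']
  simp

theorem weightSum_add {q : ℝ} (hq0 : 0 ≤ q) (hq1 : q < 1) (h : IsoPair s₁ s₂) :
    weightSum q (s₁ + s₂ * star s₂) = weightSum q s₁ + s₂ * star s₂ :=
  weightSum_add_proj hq0 hq1 h.norm_le₁ h.isStarProjection
    (by rw [← mul_assoc, h.mul_eq_zero, zero_mul]) (by rw [mul_assoc, h.orth', mul_zero])

theorem eq_of_weightSum_eq {q : ℝ} (hq0 : 0 ≤ q) (hq1 : q < 1) (h : IsoPair s₁ s₂) {t₁ t₂ : A}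
    (h' : IsoPair t₁ t₂) (e₁ : weightSum q s₁ = weightSum q t₁)
    (e₂ : weightSum q s₂ = weightSum q t₂) : s₁ = t₁ ∧ s₂ = t₂ := by
  have h2 := QBall.eq_of_weightSum_eq hq0 hq1 h.iso₂ h'.iso₂ e₂
  subst h2
  refine ⟨?_, rfl⟩
  have h3 := QBall.eq_of_weightSum_eq hq0 hq1 h.add_isometry h'.add_isometry
    (by rw [h.weightSum_add hq0 hq1, h'.weightSum_add hq0 hq1, e₁])
  exact add_right_cancel h3

theorem rel_add_iff (q : ℝ) {x r : A} (hr : IsStarProjection r) (h : x * r = 0)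
    (h' : r * x = 0) :
    star (x + r) * (x + r) - (q : ℂ) • ((x + r) * star (x + r)) = ((1 - q : ℝ) : ℂ) • 1 ↔
      star x * x - (q : ℂ) • (x * star x) = ((1 - q : ℝ) : ℂ) • (1 - r) := by
  have hrr : r * r = r := hr.isIdempotentElem
  have hrs : star r = r := hr.isSelfAdjoint
  have h1 : r * star x = 0 := by simpa [hrs] using congrArg star h
  have h2 : star x * r = 0 := by simpa [hrs] using congrArg star h'
  have e : star (x + r) * (x + r) - (q : ℂ) • ((x + r) * star (x + r))
      = star x * x - (q : ℂ) • (x * star x) + ((1 - q : ℝ) : ℂ) • r := by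
    simp only [star_add, hrs, add_mul, mul_add, h, h', h1, h2, hrr, add_zero, zero_add]
    push_cast
    module
  rw [e, smul_sub, eq_sub_iff_add_eq]

theorem ballPair {q : ℝ} (hq0 : 0 ≤ q) (hq1 : q < 1) (h : IsoPair s₁ s₂) :
    BallPair q (weightSum q s₁) (weightSum q s₂) := by
  have e1 : weightSum q s₁ * s₂ = 0 :=
    weightSum_mul_eq_zero hq0 hq1 h.norm_le₁ h.mul_eq_zero h.orth
  have e2 : star s₂ * weightSum q s₁ = 0 :=
    mul_weightSum_eq_zero hq0 hq1 h.norm_le₁ h.orth'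
  have e3 : star (weightSum q s₁) * s₂ = 0 := by simpa using congrArg star e2
  refine ⟨?_, ?_, weightSum_rel hq0 hq1 h.iso₂, ?_⟩
  · rw [weightSum_eq_mul_modulus hq0 hq1 h.iso₂, ← mul_assoc, e1, zero_mul]
  · rw [weightSum_eq_mul_modulus hq0 hq1 h.iso₂, ← mul_assoc, e3, zero_mul]
  · rw [weightSum_mul_inverse hq0 hq1 h.iso₂, ← rel_add_iff q h.isStarProjection
      (by rw [← mul_assoc, e1, zero_mul]) (by rw [mul_assoc, e2, mul_zero]),
      ← h.weightSum_add hq0 hq1]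
    exact weightSum_rel hq0 hq1 h.add_isometry

end IsoPair

theorem commute_of_commute_weightSum {q : ℝ} (hq0 : 0 ≤ q) (hq1 : q < 1) {r t : A}
    (hr : IsStarProjection r) (ht : star t * t = 1) (h : Commute r (weightSum q t)) :
    Commute r t := by
  have hrr : r * r = r := hr.isIdempotentElem
  set w : A := 1 - (2 : ℂ) • r with hw
  have hws : star w = w := by simp [hw, hr.isSelfAdjoint.star_eq]
  have hww : w * w = 1 := by
    simp only [hw, mul_sub, sub_mul, mul_one, one_mul, smul_mul_assoc, mul_smul_comm, hrr]
    module
  have hwt : Commute w (weightSum q t) := (Commute.one_left _).sub_left (h.smul_left _)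
  have hiso : star (w * t * star w) * (w * t * star w) = 1 := by
    rw [hws, star_mul, star_mul, hws]
    calc w * (star t * w) * (w * t * w) = w * (star t * (w * w) * t) * w := by
          simp only [mul_assoc]
      _ = 1 := by rw [hww, mul_one, ht, mul_one, hww]
  have e : w * t * star w = t := by
    refine eq_of_weightSum_eq hq0 hq1 hiso ht ?_
    rw [weightSum_conj hq0 hq1 (by rw [hws, hww]) (norm_le_one_of_isometry ht), hwt.eq, hws,
      mul_assoc, hww, mul_one]
  have e2 : w * t = t * w := by
    conv_rhs => rw [← e, hws, mul_assoc, hww, mul_one]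
  have e3 : (2 : ℂ) • (r * t) = (2 : ℂ) • (t * r) := by
    simpa [hw, sub_mul, mul_sub, smul_mul_assoc, mul_smul_comm] using e2
  exact smul_right_injective A (two_ne_zero (α := ℂ)) e3

theorem BallPair.exists_isoPair {q : ℝ} (hq0 : 0 ≤ q) (hq1 : q < 1) {x₁ x₂ : A}
    (h : BallPair q x₁ x₂) :
    ∃ s₁ s₂ : A, IsoPair s₁ s₂ ∧ weightSum q s₁ = x₁ ∧ weightSum q s₂ = x₂ := by
  obtain ⟨s₂, hs₂, rfl⟩ := exists_isometry_of_rel hq0 hq1 h.rel₂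
  have hr := isStarProjection_mul_star hs₂
  have hinv := weightSum_mul_inverse hq0 hq1 hs₂
  have h1 : x₁ * (s₂ * star s₂) = 0 := by
    rw [← hinv, ← mul_assoc, ← mul_assoc, h.mul_eq_zero, zero_mul, zero_mul]
  have h2 : (s₂ * star s₂) * x₁ = 0 := by
    have : star x₁ * (s₂ * star s₂) = 0 := by
      rw [← hinv, ← mul_assoc, ← mul_assoc, h.star_mul_eq_zero, zero_mul, zero_mul]
    simpa [mul_assoc] using congrArg star this
  have h3 := (IsoPair.rel_add_iff q hr h1 h2).2 (hinv ▸ h.rel₁)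
  obtain ⟨t, ht, hty⟩ := exists_isometry_of_rel hq0 hq1 h3
  have hrr : s₂ * star s₂ * (s₂ * star s₂) = s₂ * star s₂ := hr.isIdempotentElem
  have hcomm : Commute (s₂ * star s₂) t := by
    refine commute_of_commute_weightSum hq0 hq1 hr ht ?_
    rw [hty, Commute, SemiconjBy, mul_add, add_mul, h1, h2]
  have hcomm' : Commute (1 - s₂ * star s₂) t := (Commute.one_left t).sub_left hcomm
  have hp := hr.one_sub
  have hpp : (1 - s₂ * star s₂) * (1 - s₂ * star s₂) = 1 - s₂ * star s₂ := hp.isIdempotentElem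
  have hps : star (1 - s₂ * star s₂) = 1 - s₂ * star s₂ := hp.isSelfAdjoint
  have hcs : Commute (1 - s₂ * star s₂) (star t) := by
    have := hcomm'.star_star
    rwa [hps] at this
  refine ⟨t * (1 - s₂ * star s₂), s₂, ⟨hs₂, ?_, ?_⟩, ?_, rfl⟩
  · rw [star_mul, hps, mul_assoc, ← mul_assoc (star t), ht, one_mul, hpp]
  · rw [star_mul, hps, hcs.eq, mul_assoc, sub_mul, mul_assoc s₂, hs₂]
    simp
  · rw [weightSum_mul_proj hq0 hq1 hp (norm_le_one_of_isometry ht) hcomm', hty, mul_sub, mul_one,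
      add_mul, h1, hrr]
    abel

end Pairs

section Lift

variable {G : Type} (R : Presentation G)

/-- The `*`-homomorphism of the free `*`-algebra with prescribed values at the generators. -/
def Pre.lift {B : Type*} [Ring B] [StarRing B] [Algebra ℂ B] [StarModule ℂ B] (t : G → B) :
    Pre R →⋆ₐ[ℂ] B :=
  let φ : FreeStar G →ₐ[ℂ] B := MonoidAlgebra.lift ℂ B (FreeMonoid (G ⊕ G))
    (FreeMonoid.lift (Sum.elim t fun g => star (t g)))
  have h1 : ∀ s, φ (MonoidAlgebra.of ℂ _ (FreeMonoid.of s)) = Sum.elim t (fun g => star (t g)) s :=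
    fun s => by simp [φ]
  { φ with
    map_star' := fun a => by
      change φ (star (a : FreeStar G)) = star (φ a)
      refine FreeStar.induct (p := fun a => φ (star a) = star (φ a)) ?_ ?_ ?_ ?_ a
      · simp
      · intro a b ha hb; simp [ha, hb]
      · intro c a ha; simp [ha]
      · intro s a ha
        rw [star_mul, map_mul, map_mul, star_mul, ha, FreeStar.star_def, FreeStar.starHom_of,
          MulOpposite.unop_op, h1, h1]
        cases s <;> simp }

theorem Pre.lift_gen {B : Type*} [Ring B] [StarRing B] [Algebra ℂ B] [StarModule ℂ B]
    (t : G → B) (g : G) : Pre.lift R t (Pre.gen R g) = t g := by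
  change MonoidAlgebra.lift ℂ B (FreeMonoid (G ⊕ G))
    (FreeMonoid.lift (Sum.elim t fun g => star (t g))) (FreeStar.gen g) = t g
  simp [FreeStar.gen]

namespace CStar

/-- The canonical `*`-homomorphism of the free `*`-algebra. -/
def ofPre : Pre R →⋆ₐ[ℂ] CStar R where
  toFun a := incl R (PolyAlg.mk R a)
  map_one' := UniformSpace.Completion.coe_one _
  map_mul' a b := by rw [PolyAlg.mk_mul, incl_mul]
  map_zero' := UniformSpace.Completion.coe_zero
  map_add' a b := by rw [PolyAlg.mk_add, incl_add]
  commutes' c := by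
    rw [Algebra.algebraMap_eq_smul_one, Algebra.algebraMap_eq_smul_one, PolyAlg.mk_smul, incl_smul]
    exact congrArg (c • ·) (UniformSpace.Completion.coe_one _)
  map_star' a := by rw [PolyAlg.mk_star, incl_star]

theorem ofPre_gen (g : G) : ofPre R (Pre.gen R g) = gen R g := rfl

theorem norm_ofPre (a : Pre R) : ‖ofPre R a‖ = ‖a‖ := norm_incl R _

theorem denseRange_ofPre : DenseRange (ofPre R) :=
  (denseRange_incl R).comp (PolyAlg.mk_surjective R).denseRange
    (UniformSpace.Completion.continuous_coe (PolyAlg R))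

theorem exists_lift_of_norm_le {B : Type*} [CStarAlgebra B] (π : Pre R →⋆ₐ[ℂ] B)
    (h : ∀ a, ‖π a‖ ≤ ‖a‖) : ∃ Φ : CStar R →⋆ₐ[ℂ] B, ∀ a, Φ (ofPre R a) = π a := by
  have hd := denseRange_ofPre R
  let e : Pre R →L[ℂ] CStar R := LinearMap.mkContinuous (ofPre R).toAlgHom.toLinearMap 1
    fun a => by rw [one_mul]; exact (norm_ofPre R a).le
  have hde : DenseRange e := hd
  have hue : IsUniformInducing e :=
    (AddMonoidHomClass.isometry_of_norm e (norm_ofPre R)).isUniformInducing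
  let f : Pre R →L[ℂ] B := LinearMap.mkContinuous π.toAlgHom.toLinearMap 1
    fun a => by rw [one_mul]; exact h a
  let F : CStar R →L[ℂ] B := f.extend e
  have hF : ∀ a, F (ofPre R a) = π a := fun a => f.extend_eq hde hue a
  have hF1 : F 1 = 1 := by rw [← map_one (ofPre R), hF, map_one]
  refine ⟨{
    toFun := F
    map_one' := hF1
    map_mul' := fun x y => ?_
    map_zero' := map_zero F
    map_add' := map_add F
    commutes' := fun c => ?_
    map_star' := fun x => ?_ }, hF⟩
  · refine hd.induction_on₂ (p := fun x y => F (x * y) = F x * F y)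
      (isClosed_eq (F.continuous.comp continuous_mul)
        ((F.continuous.comp continuous_fst).mul (F.continuous.comp continuous_snd)))
      (fun a b => ?_) x y
    rw [← map_mul, hF, hF, hF, map_mul]
  · rw [Algebra.algebraMap_eq_smul_one, Algebra.algebraMap_eq_smul_one, map_smul, hF1]
  · refine hd.induction_on (p := fun x => F (star x) = star (F x)) x
      (isClosed_eq (F.continuous.comp continuous_star) F.continuous.star) fun a => ?_
    rw [← map_star, hF, hF, map_star]

/-- To prove a closed property of all elements which is compatible with the algebraic
operations, consider the generators. -/
theorem induct {p : CStar R → Prop} (closed : IsClosed {x | p x}) (one : p 1)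
    (add : ∀ a b, p a → p b → p (a + b)) (smul : ∀ (c : ℂ) a, p a → p (c • a))
    (gen_mul : ∀ g a, p a → p (gen R g * a)) (star_gen_mul : ∀ g a, p a → p (star (gen R g) * a))
    (x : CStar R) : p x := by
  refine (denseRange_ofPre R).induction_on x closed fun a => ?_
  induction a using Pre.induct with
  | one => rwa [map_one]
  | add a b ha hb => rw [map_add]; exact add _ _ ha hb
  | smul c a ha => rw [map_smul]; exact smul _ _ ha
  | gen_mul g a ha => rw [map_mul]; exact gen_mul _ _ ha
  | star_gen_mul g a ha => rw [map_mul, map_star]; exact star_gen_mul _ _ ha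

open scoped CStarAlgebra in
theorem hom_ext {B : Type*} [CStarAlgebra B] {Φ Ψ : CStar R →⋆ₐ[ℂ] B}
    (h : ∀ g, Φ (gen R g) = Ψ (gen R g)) : Φ = Ψ := by
  ext x
  induction x using CStar.induct with
  | closed => exact isClosed_eq (map_continuous Φ) (map_continuous Ψ)
  | one => rw [map_one, map_one]
  | add a b ha hb => rw [map_add, map_add, ha, hb]
  | smul c a ha => rw [map_smul, map_smul, ha]
  | gen_mul g a ha => rw [map_mul, map_mul, ha, h]
  | star_gen_mul g a ha => rw [map_mul, map_mul, map_star, map_star, ha, h]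

/-- The norm is detected by the representations which satisfy the relations. -/
theorem norm_le_of_forall_rep (x : CStar R) {C : ℝ} (hC : 0 ≤ C)
    (h : ∀ (H : Type) [NormedAddCommGroup H] [InnerProductSpace ℂ H] [CompleteSpace H]
      (ρ : CStar R →⋆ₐ[ℂ] (H →L[ℂ] H)), R.Rel H (fun g => ρ (gen R g)) → ‖ρ x‖ ≤ C) :
    ‖x‖ ≤ C := by
  refine le_of_forall_pos_le_add fun ε hε => ?_
  obtain ⟨a, ha⟩ := (denseRange_ofPre R).exists_dist_lt x (half_pos hε)
  rw [dist_eq_norm] at ha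
  have h1 : ‖ofPre R a‖ ≤ C + ε / 2 := by
    rw [norm_ofPre]
    refine Pre.norm_le' R a (by positivity) fun H _ _ _ π hπ => ?_
    obtain ⟨ρ, hρ⟩ := exists_lift_of_norm_le R π fun b => Pre.le_norm' R b H π hπ
    have h2 := h H ρ (by simpa only [← ofPre_gen, hρ] using hπ)
    have h3 : ‖ρ (x - ofPre R a)‖ ≤ ‖x - ofPre R a‖ := NonUnitalStarAlgHom.norm_apply_le ρ _
    rw [← hρ]
    calc ‖ρ (ofPre R a)‖ = ‖ρ x - ρ (x - ofPre R a)‖ := by rw [map_sub, sub_sub_cancel]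
      _ ≤ ‖ρ x‖ + ‖ρ (x - ofPre R a)‖ := norm_sub_le _ _
      _ ≤ C + ε / 2 := add_le_add h2 (h3.trans ha.le)
  calc ‖x‖ = ‖ofPre R a + (x - ofPre R a)‖ := by rw [add_sub_cancel]
    _ ≤ ‖ofPre R a‖ + ‖x - ofPre R a‖ := norm_add_le _ _
    _ ≤ (C + ε / 2) + ε / 2 := add_le_add h1 ha.le
    _ = C + ε := by ring

/-- The representations which satisfy the relations separate the elements. -/
theorem eq_of_forall_rep {x y : CStar R}
    (h : ∀ (H : Type) [NormedAddCommGroup H] [InnerProductSpace ℂ H] [CompleteSpace H]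
      (ρ : CStar R →⋆ₐ[ℂ] (H →L[ℂ] H)), R.Rel H (fun g => ρ (gen R g)) → ρ x = ρ y) :
    x = y := by
  refine sub_eq_zero.1 (norm_le_zero_iff.1 (norm_le_of_forall_rep R _ le_rfl
    fun H _ _ _ ρ hρ => ?_))
  rw [map_sub, h H ρ hρ, sub_self, norm_zero]

/-- A `*`-homomorphism is defined by elements which satisfy the relations in all
representations. -/
theorem exists_hom {G' : Type} (R' : Presentation G') (t : G → CStar R')
    (h : ∀ (H : Type) [NormedAddCommGroup H] [InnerProductSpace ℂ H] [CompleteSpace H]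
      (ρ : CStar R' →⋆ₐ[ℂ] (H →L[ℂ] H)), R'.Rel H (fun g => ρ (gen R' g)) →
        R.Rel H (fun g => ρ (t g))) :
    ∃ Φ : CStar R →⋆ₐ[ℂ] CStar R', ∀ g, Φ (gen R g) = t g := by
  obtain ⟨Φ, hΦ⟩ := exists_lift_of_norm_le R (Pre.lift R t) fun a =>
    norm_le_of_forall_rep R' _ (norm_nonneg a) fun H _ _ _ ρ hρ =>
      Pre.le_norm' R a H (ρ.comp (Pre.lift R t)) (by
        simpa only [StarAlgHom.comp_apply, Pre.lift_gen] using h H ρ hρ)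
  exact ⟨Φ, fun g => by rw [← ofPre_gen, hΦ, Pre.lift_gen]⟩

end CStar

end Lift

section Family

set_option linter.constructorNameAsVariable false

variable {A : Type*} [CStarAlgebra A]

/-- Projections whose sum is a projection are mutually orthogonal. -/
theorem mul_eq_zero_of_isStarProjection_sum {ι : Type*} {t : Finset ι} {r : ι → A}
    (hr : ∀ i ∈ t, IsStarProjection (r i)) (h : IsStarProjection (∑ i ∈ t, r i)) {i j : ι}
    (hi : i ∈ t) (hj : j ∈ t) (hij : i ≠ j) : r i * r j = 0 := by
  classical
  let _ := CStarAlgebra.spectralOrder A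
  have _ := CStarAlgebra.spectralOrderedRing A
  have hjs : star (r j) = r j := (hr j hj).isSelfAdjoint
  have hjj : r j * r j = r j := (hr j hj).isIdempotentElem
  have hsq : ∀ k ∈ t, r j * r k * r j = star (r k * r j) * (r k * r j) := fun k hk => by
    rw [star_mul, hjs, (hr k hk).isSelfAdjoint.star_eq, mul_assoc, mul_assoc, ← mul_assoc (r k),
      (hr k hk).isIdempotentElem.eq]
  have h1 : 0 ≤ r j * (1 - ∑ k ∈ t, r k) * r j := by
    have := star_left_conjugate_nonneg h.one_sub.nonneg (r j)
    rwa [hjs] at this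
  have h2 : r j * (1 - ∑ k ∈ t, r k) * r j = -∑ k ∈ t.erase j, r j * r k * r j := by
    rw [← Finset.add_sum_erase t r hj, mul_sub, mul_one, mul_add, hjj, sub_mul, add_mul, hjj,
      Finset.mul_sum, Finset.sum_mul]
    abel
  have h3 : ∀ k ∈ t.erase j, 0 ≤ r j * r k * r j := fun k hk => by
    rw [hsq k (Finset.mem_of_mem_erase hk)]
    exact star_mul_self_nonneg _
  have h4 : ∑ k ∈ t.erase j, r j * r k * r j = 0 :=
    le_antisymm (neg_nonneg.1 (h2 ▸ h1)) (Finset.sum_nonneg h3)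
  have h5 := (Finset.sum_eq_zero_iff_of_nonneg h3).1 h4 i (Finset.mem_erase.2 ⟨hij, hi⟩)
  rw [hsq i hi] at h5
  exact (CStarRing.star_mul_self_eq_zero_iff _).1 h5

/-- Cuntz-Krieger families of the graph `E₂` in a `C^*`-algebra. -/
structure E2Family (p : Vert2 → A) (s : Edge2 → A) : Prop where
  proj : ∀ v, IsStarProjection (p v)
  orthogonal : ∀ v w, v ≠ w → p v * p w = 0
  initial : ∀ e, star (s e) * s e = p (E2.rng e)
  sum_u : p .u = s .a * star (s .a) + s .c * star (s .c) + s .d * star (s .d)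
  sum_v : p .v = s .b * star (s .b) + s .e * star (s .e)

theorem sum_edges_u {M : Type*} [AddCommMonoid M] (f : Edge2 → M) :
    ∑ e ∈ ({.a, .c, .d} : Finset Edge2), f e = f .a + f .c + f .d := by
  rw [Finset.sum_insert (by decide), Finset.sum_insert (by decide), Finset.sum_singleton, add_assoc]

theorem sum_edges_v {M : Type*} [AddCommMonoid M] (f : Edge2 → M) :
    ∑ e ∈ ({.b, .e} : Finset Edge2), f e = f .b + f .e := by
  rw [Finset.sum_insert (by decide), Finset.sum_singleton]

namespace E2Family

variable {p : Vert2 → A} {s : Edge2 → A}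

theorem edge_mul_rng (h : E2Family p s) (e : Edge2) : s e * p (E2.rng e) = s e := by
  have h1 := (h.proj (E2.rng e)).isIdempotentElem.eq
  have h2 := (h.proj (E2.rng e)).isSelfAdjoint.star_eq
  refine (sub_eq_zero.1 ((CStarRing.star_mul_self_eq_zero_iff _).1 ?_)).symm
  have h3 : star (s e - s e * p (E2.rng e)) * (s e - s e * p (E2.rng e))
      = star (s e) * s e - star (s e) * s e * p (E2.rng e) - p (E2.rng e) * (star (s e) * s e)
        + p (E2.rng e) * (star (s e) * s e) * p (E2.rng e) := by
    rw [star_sub, star_mul, h2]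
    noncomm_ring
  rw [h3, h.initial, h1, h1]
  abel

theorem isStarProjection_range (h : E2Family p s) (e : Edge2) :
    IsStarProjection (s e * star (s e)) :=
  ⟨by rw [IsIdempotentElem, mul_assoc, ← mul_assoc (star (s e)), h.initial, ← mul_assoc,
    h.edge_mul_rng], by simp [IsSelfAdjoint]⟩

theorem star_mul_eq_zero_of_range (h : E2Family p s) {e f : Edge2}
    (hef : s e * star (s e) * (s f * star (s f)) = 0) : star (s e) * s f = 0 := by
  have h1 : ∀ e, s e * star (s e) * s e = s e := fun e => by
    rw [mul_assoc, h.initial, h.edge_mul_rng]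
  rw [← h1 f]
  have h2 : star (s e) = star (s e) * (s e * star (s e)) := by
    conv_lhs => rw [← h1 e]
    simp
  rw [h2, mul_assoc, ← mul_assoc _ _ (s f), hef, zero_mul, mul_zero]

theorem star_mul_eq_zero_of_src_eq (h : E2Family p s) {e f : Edge2} (hef : e ≠ f)
    (hs : E2.src e = E2.src f) : star (s e) * s f = 0 := by
  refine h.star_mul_eq_zero_of_range ?_
  have hu : IsStarProjection (∑ e ∈ ({.a, .c, .d} : Finset Edge2), s e * star (s e)) := by
    rw [sum_edges_u, ← h.sum_u]
    exact h.proj .u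
  have hv : IsStarProjection (∑ e ∈ ({.b, .e} : Finset Edge2), s e * star (s e)) := by
    rw [sum_edges_v, ← h.sum_v]
    exact h.proj .v
  have hu' := fun i j => mul_eq_zero_of_isStarProjection_sum
    (fun i _ => h.isStarProjection_range i) hu (i := i) (j := j)
  have hv' := fun i j => mul_eq_zero_of_isStarProjection_sum
    (fun i _ => h.isStarProjection_range i) hv (i := i) (j := j)
  cases e <;> cases f <;> first
    | exact absurd rfl hef
    | exact absurd hs (by decide)
    | exact hu' _ _ (by decide) (by decide) (by decide)
    | exact hv' _ _ (by decide) (by decide) (by decide)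

theorem src_mul_edge (h : E2Family p s) (e : Edge2) : p (E2.src e) * s e = s e := by
  have h1 : ∀ f, s f * star (s f) * s f = s f := fun f => by
    rw [mul_assoc, h.initial, h.edge_mul_rng]
  have h2 : ∀ f, f ≠ e → E2.src f = E2.src e → s f * star (s f) * s e = 0 := fun f hf hs => by
    rw [mul_assoc, h.star_mul_eq_zero_of_src_eq hf hs, mul_zero]
  cases e <;>
    simp only [h.sum_u, h.sum_v, add_mul, h1, h2, ne_eq, reduceCtorEq, not_false_eq_true,
      add_zero, zero_add]

theorem edge_mul_vert (h : E2Family p s) (e : Edge2) (v : Vert2) :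
    s e * p v = if v = E2.rng e then s e else 0 := by
  split_ifs with hv
  · rw [hv, h.edge_mul_rng]
  · rw [← h.edge_mul_rng, mul_assoc, h.orthogonal _ _ (Ne.symm hv), mul_zero]

theorem vert_mul_edge (h : E2Family p s) (e : Edge2) (v : Vert2) :
    p v * s e = if v = E2.src e then s e else 0 := by
  split_ifs with hv
  · rw [hv, h.src_mul_edge]
  · rw [← h.src_mul_edge, ← mul_assoc, h.orthogonal _ _ hv, zero_mul]

theorem star_edge_mul_edge (h : E2Family p s) (e f : Edge2) :
    star (s e) * s f = if e = f then p (E2.rng e) else 0 := by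
  split_ifs with hef
  · rw [← hef, h.initial]
  · by_cases hs : E2.src e = E2.src f
    · exact h.star_mul_eq_zero_of_src_eq hef hs
    · rw [← h.src_mul_edge e, ← h.src_mul_edge f, star_mul,
        (h.proj _).isSelfAdjoint.star_eq, mul_assoc, ← mul_assoc (p _) (p _),
        h.orthogonal _ _ hs, zero_mul, mul_zero]

theorem edge_mul_star_edge (h : E2Family p s) {e f : Edge2} (hef : E2.rng e ≠ E2.rng f) :
    s e * star (s f) = 0 := by
  rw [← h.edge_mul_rng e, ← h.edge_mul_rng f, star_mul, (h.proj _).isSelfAdjoint.star_eq,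
    mul_assoc, ← mul_assoc (p _) (p _), h.orthogonal _ _ hef, zero_mul, mul_zero]

end E2Family

/-- `P_u + P_v + P_w`, the unit of the `C^*`-algebra of the family. -/
def vertSum (p : Vert2 → A) : A := p .u + p .v + p .w

/-- `S₁ = S_b + S_e`. -/
def isoOne (s : Edge2 → A) : A := s .b + s .e

/-- `S₂ = S_a + S_c + S_d`. -/
def isoTwo (s : Edge2 → A) : A := s .a + s .c + s .d

namespace E2Family

variable {p : Vert2 → A} {s : Edge2 → A}

theorem isStarProjection_vertSum (h : E2Family p s) : IsStarProjection (vertSum p) := by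
  refine ⟨?_, ?_⟩
  · have h1 := fun v => (h.proj v).isIdempotentElem.eq
    simp [IsIdempotentElem, vertSum, mul_add, add_mul, h1, h.orthogonal]
  · have h2 := fun v => (h.proj v).isSelfAdjoint.star_eq
    simp [IsSelfAdjoint, vertSum, h2]

theorem vertSum_mul_edge (h : E2Family p s) (e : Edge2) : vertSum p * s e = s e := by
  cases e <;> simp [vertSum, add_mul, h.vert_mul_edge]

theorem edge_mul_vertSum (h : E2Family p s) (e : Edge2) : s e * vertSum p = s e := by
  cases e <;> simp [vertSum, mul_add, h.edge_mul_vert]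

theorem star_edge_mul_vertSum (h : E2Family p s) (e : Edge2) :
    star (s e) * vertSum p = star (s e) := by
  simpa [h.isStarProjection_vertSum.isSelfAdjoint.star_eq] using
    congrArg star (h.vertSum_mul_edge e)

theorem vertSum_mul_star_edge (h : E2Family p s) (e : Edge2) :
    vertSum p * star (s e) = star (s e) := by
  simpa [h.isStarProjection_vertSum.isSelfAdjoint.star_eq] using
    congrArg star (h.edge_mul_vertSum e)

theorem isoTwo_mul_star (h : E2Family p s) :
    (isoTwo s + (1 - vertSum p)) * star (isoTwo s + (1 - vertSum p))
      = p .u + (1 - vertSum p) := by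
  have h1 := h.isStarProjection_vertSum.isSelfAdjoint.star_eq
  have h2 := h.isStarProjection_vertSum.isIdempotentElem.eq
  have ac := h.edge_mul_star_edge (e := .a) (f := .c) (by decide)
  have ad := h.edge_mul_star_edge (e := .a) (f := .d) (by decide)
  have ca := h.edge_mul_star_edge (e := .c) (f := .a) (by decide)
  have cd := h.edge_mul_star_edge (e := .c) (f := .d) (by decide)
  have da := h.edge_mul_star_edge (e := .d) (f := .a) (by decide)
  have dc := h.edge_mul_star_edge (e := .d) (f := .c) (by decide)
  rw [h.sum_u]
  simp only [isoTwo, star_add, star_sub, star_one, h1, mul_add, add_mul, mul_sub, sub_mul, h2,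
    mul_one, one_mul, h.edge_mul_vertSum, h.vertSum_mul_star_edge, ac, ad, ca, cd, da, dc]
  abel

theorem isoPair (h : E2Family p s) : IsoPair (isoOne s) (isoTwo s + (1 - vertSum p)) := by
  have h1 := h.isStarProjection_vertSum.isSelfAdjoint.star_eq
  have h2 := h.isStarProjection_vertSum.isIdempotentElem.eq
  refine ⟨?_, ?_, ?_⟩
  · simp only [isoTwo, star_add, star_sub, star_one, h1, mul_add, add_mul, mul_sub, sub_mul, h2,
      mul_one, one_mul, h.vertSum_mul_edge, h.star_edge_mul_vertSum, h.star_edge_mul_edge,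
      reduceCtorEq, if_true, if_false]
    simp only [vertSum]
    abel
  · rw [h.isoTwo_mul_star]
    simp only [isoOne, star_add, mul_add, add_mul, h.star_edge_mul_edge,
      reduceCtorEq, if_true, if_false, vertSum]
    abel
  · simp only [isoOne, isoTwo, star_add, mul_add, add_mul, mul_sub, mul_one,
      h.star_edge_mul_vertSum, h.star_edge_mul_edge, reduceCtorEq, if_false]
    abel

theorem commute_isoOne (h : E2Family p s) : Commute (vertSum p) (isoOne s) := by
  simp [Commute, SemiconjBy, isoOne, mul_add, add_mul, h.vertSum_mul_edge, h.edge_mul_vertSum]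

theorem isoOne_mul_vertSum (h : E2Family p s) : isoOne s * vertSum p = isoOne s := by
  simp [isoOne, add_mul, h.edge_mul_vertSum]

theorem isoTwo_add_mul_vertSum (h : E2Family p s) :
    (isoTwo s + (1 - vertSum p)) * vertSum p = isoTwo s := by
  have h2 := h.isStarProjection_vertSum.isIdempotentElem.eq
  simp [isoTwo, add_mul, sub_mul, h2, h.edge_mul_vertSum]

theorem vertSum_mul_isoTwo_add (h : E2Family p s) :
    vertSum p * (isoTwo s + (1 - vertSum p)) = isoTwo s := by
  have h2 := h.isStarProjection_vertSum.isIdempotentElem.eq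
  simp [isoTwo, mul_add, mul_sub, h2, h.vertSum_mul_edge]

theorem commute_isoTwo (h : E2Family p s) :
    Commute (vertSum p) (isoTwo s + (1 - vertSum p)) := by
  rw [Commute, SemiconjBy, h.vertSum_mul_isoTwo_add, h.isoTwo_add_mul_vertSum]

end E2Family

/-- The vertex projections which belong to an `IsoPair`. -/
def pairVert (s₁ s₂ : A) : Vert2 → A
  | .u => s₂ * star s₂
  | .v => s₁ * star s₁
  | .w => 1 - s₂ * star s₂ - s₁ * star s₁

/-- The partial isometries which belong to an `IsoPair`. -/
def pairEdge (s₁ s₂ : A) : Edge2 → A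
  | .a => s₂ * pairVert s₁ s₂ .u
  | .b => s₁ * pairVert s₁ s₂ .v
  | .c => s₂ * pairVert s₁ s₂ .v
  | .d => s₂ * pairVert s₁ s₂ .w
  | .e => s₁ * pairVert s₁ s₂ .w

theorem map_pairVert {B : Type*} [CStarAlgebra B] (f : A →⋆ₐ[ℂ] B) (s₁ s₂ : A) (v : Vert2) :
    f (pairVert s₁ s₂ v) = pairVert (f s₁) (f s₂) v := by
  cases v <;> simp [pairVert, map_star]

theorem map_pairEdge {B : Type*} [CStarAlgebra B] (f : A →⋆ₐ[ℂ] B) (s₁ s₂ : A) (e : Edge2) :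
    f (pairEdge s₁ s₂ e) = pairEdge (f s₁) (f s₂) e := by
  cases e <;> simp [pairEdge, map_pairVert]

theorem vertSum_pairVert (s₁ s₂ : A) : vertSum (pairVert s₁ s₂) = 1 := by
  simp only [vertSum, pairVert]; abel

theorem isoTwo_pairEdge (s₁ s₂ : A) : isoTwo (pairEdge s₁ s₂) = s₂ := by
  have h := vertSum_pairVert s₁ s₂
  rw [vertSum] at h
  simp only [isoTwo, pairEdge]
  rw [← mul_add, ← mul_add, h, mul_one]

namespace IsoPair

variable {s₁ s₂ : A}

theorem isoOne_pairEdge (h : IsoPair s₁ s₂) : isoOne (pairEdge s₁ s₂) = s₁ := by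
  have h1 : s₁ * (s₂ * star s₂) = 0 := by rw [← mul_assoc, h.mul_eq_zero, zero_mul]
  simp only [isoOne, pairEdge]
  rw [← mul_add]
  simp [pairVert, mul_sub, h1]

theorem e2Family (h : IsoPair s₁ s₂) : E2Family (pairVert s₁ s₂) (pairEdge s₁ s₂) := by
  have hu : IsStarProjection (s₂ * star s₂) := h.isStarProjection
  have h1 : s₁ * (s₂ * star s₂) = 0 := by rw [← mul_assoc, h.mul_eq_zero, zero_mul]
  have hv : IsStarProjection (s₁ * star s₁) := by
    refine ⟨?_, by simp [IsSelfAdjoint]⟩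
    rw [IsIdempotentElem, mul_assoc, ← mul_assoc (star s₁), h.iso₁, ← mul_assoc, mul_sub, mul_one,
      h1, sub_zero]
  have huv : s₂ * star s₂ * (s₁ * star s₁) = 0 := by
    rw [mul_assoc, ← mul_assoc (star s₂), h.orth', zero_mul, mul_zero]
  have hvu : s₁ * star s₁ * (s₂ * star s₂) = 0 := by
    rw [mul_assoc, ← mul_assoc (star s₁), h.orth, zero_mul, mul_zero]
  have huu := hu.isIdempotentElem.eq
  have hvv := hv.isIdempotentElem.eq
  have hproj : ∀ v, IsStarProjection (pairVert s₁ s₂ v) := by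
    rintro (_ | _ | _)
    · exact hu
    · exact hv
    · refine ⟨?_, ?_⟩
      · simp only [IsIdempotentElem, pairVert, mul_sub, sub_mul, huu, hvv, huv, hvu, mul_one,
          one_mul]
        abel
      · simp [IsSelfAdjoint, pairVert]
  have hsa := fun v => (hproj v).isSelfAdjoint.star_eq
  have hid := fun v => (hproj v).isIdempotentElem.eq
  have horth : ∀ v w, v ≠ w → pairVert s₁ s₂ v * pairVert s₁ s₂ w = 0 := by
    rintro (_ | _ | _) (_ | _ | _) hvw <;> first
      | exact absurd rfl hvw
      | simp only [pairVert, mul_sub, sub_mul, huu, hvv, huv, hvu, mul_one, one_mul, sub_self,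
          sub_zero]
  have i2 : ∀ v, star (s₂ * pairVert s₁ s₂ v) * (s₂ * pairVert s₁ s₂ v) = pairVert s₁ s₂ v := by
    intro v
    rw [star_mul, hsa, mul_assoc, ← mul_assoc (star s₂), h.iso₂, one_mul, hid]
  have i1 : ∀ v, v ≠ .u →
      star (s₁ * pairVert s₁ s₂ v) * (s₁ * pairVert s₁ s₂ v) = pairVert s₁ s₂ v := by
    intro v hvu
    have h3 : s₂ * star s₂ * pairVert s₁ s₂ v = 0 := horth .u v hvu.symm
    rw [star_mul, hsa, mul_assoc, ← mul_assoc (star s₁), h.iso₁, sub_mul, one_mul, h3, sub_zero,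
      hid]
  have r : ∀ (x : A) v, x * pairVert s₁ s₂ v * star (x * pairVert s₁ s₂ v)
      = x * pairVert s₁ s₂ v * star x := by
    intro x v
    rw [star_mul, hsa, ← mul_assoc, mul_assoc x, hid]
  refine ⟨hproj, horth, ?_, ?_, ?_⟩
  · rintro (_ | _ | _ | _ | _)
    · exact i2 .u
    · exact i1 .v (by decide)
    · exact i2 .v
    · exact i2 .w
    · exact i1 .w (by decide)
  · simp only [pairEdge, r]
    rw [← add_mul, ← add_mul]
    exact (congrArg (· * star s₂) (isoTwo_pairEdge s₁ s₂)).symm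
  · simp only [pairEdge, r]
    rw [← add_mul]
    exact (congrArg (· * star s₁) h.isoOne_pairEdge).symm

end IsoPair

namespace E2Family

variable {p : Vert2 → A} {s : Edge2 → A}

theorem isoOne_mul_star (h : E2Family p s) : isoOne s * star (isoOne s) = p .v := by
  have be := h.edge_mul_star_edge (e := .b) (f := .e) (by decide)
  have eb := h.edge_mul_star_edge (e := .e) (f := .b) (by decide)
  rw [h.sum_v]
  simp [isoOne, mul_add, add_mul, be, eb]

theorem pairVert_isoPair (h : E2Family p s) (v : Vert2) :
    pairVert (isoOne s) (isoTwo s + (1 - vertSum p)) v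
      = p v + if v = .u then 1 - vertSum p else 0 := by
  cases v
  · simp only [pairVert, h.isoTwo_mul_star, if_true]
  · simp [pairVert, h.isoOne_mul_star]
  · simp only [pairVert, h.isoTwo_mul_star, h.isoOne_mul_star, reduceCtorEq, if_false]
    simp only [vertSum]
    abel

theorem vertSum_mul_pairVert (h : E2Family p s) (v : Vert2) :
    vertSum p * pairVert (isoOne s) (isoTwo s + (1 - vertSum p)) v = p v := by
  have h1 := fun v => (h.proj v).isIdempotentElem.eq
  have h2 : vertSum p * p v = p v := by
    cases v <;> simp [vertSum, add_mul, h.orthogonal, h1]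
  have h3 := h.isStarProjection_vertSum.isIdempotentElem.eq
  rw [h.pairVert_isoPair, mul_add, h2]
  split_ifs <;> simp [mul_sub, h3]

theorem vertSum_mul_pairEdge (h : E2Family p s) (e : Edge2) :
    vertSum p * pairEdge (isoOne s) (isoTwo s + (1 - vertSum p)) e = s e := by
  cases e <;>
  simp only [pairEdge, h.pairVert_isoPair] <;> rw [← mul_assoc] <;>
  simp [h.vertSum_mul_isoTwo_add, h.commute_isoOne.eq, h.isoOne_mul_vertSum] <;>
  simp [isoOne, isoTwo, add_mul, mul_add, mul_sub, h.edge_mul_vert, h.edge_mul_vertSum]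

end E2Family

theorem isCuntzKrieger_iff {H : Type} [NormedAddCommGroup H] [InnerProductSpace ℂ H]
    [CompleteSpace H] (p : Vert2 → H →L[ℂ] H) (s : Edge2 → H →L[ℂ] H) :
    IsCuntzKrieger E2 p s ↔ E2Family p s := by
  have hu : (E2.rowFinite .u).toFinset = {.a, .c, .d} := by
    ext e; cases e <;> simp
  have hv : (E2.rowFinite .v).toFinset = {.b, .e} := by
    ext e; cases e <;> simp
  refine ⟨fun h => ⟨h.proj, h.orthogonal, h.initial, ?_, ?_⟩,
    fun h => ⟨h.proj, h.orthogonal, h.initial, ?_⟩⟩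
  · rw [← sum_edges_u fun e => s e * star (s e), ← hu]; exact h.sum_range .u ⟨.a, rfl⟩
  · rw [← sum_edges_v fun e => s e * star (s e), ← hv]; exact h.sum_range .v ⟨.b, rfl⟩
  · rintro (_ | _ | _) hex
    · rw [hu, sum_edges_u]; exact h.sum_u
    · rw [hv, sum_edges_v]; exact h.sum_v
    · obtain ⟨e, he⟩ := hex
      cases e <;> exact absurd he (by decide)

end Family

section Main

set_option linter.constructorNameAsVariable false

open scoped CStarAlgebra

theorem BallPair.ballRel {q : ℝ} {H : Type} [NormedAddCommGroup H] [InnerProductSpace ℂ H]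
    [CompleteSpace H] {x₁ x₂ : H →L[ℂ] H} (h : BallPair q x₁ x₂) : BallRel q x₁ x₂ :=
  ⟨h.1, h.2, h.3, h.4⟩

/-- The generators of `C^*(x₁, x₂)` satisfy the relations. -/
theorem ballPair_x (q : ℝ) (hq0 : 0 < q) (hq1 : q < 1) :
    BallPair q (x1 q hq0 hq1) (x2 q hq0 hq1) := by
  have hrel₂ : star (x2 q hq0 hq1) * x2 q hq0 hq1 - (q : ℂ) • (x2 q hq0 hq1 * star (x2 q hq0 hq1))
      = ((1 - q : ℝ) : ℂ) • 1 := by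
    refine CStar.eq_of_forall_rep _ fun H _ _ _ ρ hρ => ?_
    simp only [map_sub, map_mul, map_star, map_smul, map_one]
    exact BallRel.rel₂ hρ
  refine ⟨?_, ?_, hrel₂, ?_⟩
  · refine CStar.eq_of_forall_rep _ fun H _ _ _ ρ hρ => ?_
    rw [map_mul, map_zero]
    exact BallRel.mul_eq_zero hρ
  · refine CStar.eq_of_forall_rep _ fun H _ _ _ ρ hρ => ?_
    rw [map_mul, map_star, map_zero]
    exact BallRel.star_mul_eq_zero hρ
  · obtain ⟨s, hs, hsx⟩ := exists_isometry_of_rel hq0.le hq1 hrel₂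
    refine CStar.eq_of_forall_rep _ fun H _ _ _ ρ hρ => ?_
    have h1 := BallRel.rel₁ hρ
    have hs' : star (ρ s) * ρ s = 1 := by rw [← map_star, ← map_mul, hs, map_one]
    have h2 : ρ (x2 q hq0 hq1) = weightSum q (ρ s) := by
      rw [← hsx, map_weightSum hq0.le hq1 ρ (norm_le_one_of_isometry hs)]
    change star (ρ (x1 q hq0 hq1)) * ρ (x1 q hq0 hq1)
      - (q : ℂ) • (ρ (x1 q hq0 hq1) * star (ρ (x1 q hq0 hq1))) = ((1 - q : ℝ) : ℂ) •
        (1 - ρ (x2 q hq0 hq1) * Ring.inverse (star (ρ (x2 q hq0 hq1)) * ρ (x2 q hq0 hq1))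
          * star (ρ (x2 q hq0 hq1))) at h1
    rw [h2, weightSum_mul_inverse hq0.le hq1 hs'] at h1
    rw [← hsx, weightSum_mul_inverse hq0.le hq1 hs]
    simpa only [map_sub, map_mul, map_star, map_smul, map_one] using h1

/-- The projections `P_v`, as elements of the unital algebra which contains `C^*(E₂)`. -/
def vert (v : Vert2) : CStar (cuntzKrieger E2) := CStar.gen (cuntzKrieger E2) (Sum.inl v)

/-- The partial isometries `S_e`, as elements of the unital algebra which contains `C^*(E₂)`. -/
def edge (e : Edge2) : CStar (cuntzKrieger E2) := CStar.gen (cuntzKrieger E2) (Sum.inr e)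

theorem e2Family_gen : E2Family vert edge := by
  have h : ∀ {x y : CStar (cuntzKrieger E2)}, (∀ (H : Type) [NormedAddCommGroup H]
      [InnerProductSpace ℂ H] [CompleteSpace H] (ρ : CStar (cuntzKrieger E2) →⋆ₐ[ℂ] (H →L[ℂ] H)),
      E2Family (fun v => ρ (vert v)) (fun e => ρ (edge e)) → ρ x = ρ y) → x = y :=
    fun {x y} h => CStar.eq_of_forall_rep _ fun H _ _ _ ρ hρ =>
      h H ρ ((isCuntzKrieger_iff _ _).1 hρ)
  refine ⟨fun v => ⟨h fun H _ _ _ ρ hρ => ?_, h fun H _ _ _ ρ hρ => ?_⟩,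
    fun v w hvw => h fun H _ _ _ ρ hρ => ?_, fun e => h fun H _ _ _ ρ hρ => ?_,
    h fun H _ _ _ ρ hρ => ?_, h fun H _ _ _ ρ hρ => ?_⟩
  · rw [map_mul]; exact (hρ.proj v).isIdempotentElem
  · rw [map_star]; exact (hρ.proj v).isSelfAdjoint
  · rw [map_mul, map_zero]; exact hρ.orthogonal v w hvw
  · rw [map_mul, map_star]; exact hρ.initial e
  · simp only [map_add, map_mul, map_star]; exact hρ.sum_u
  · simp only [map_add, map_mul, map_star]; exact hρ.sum_v

theorem commute_weightSum {A : Type*} [CStarAlgebra A] {q : ℝ} (hq0 : 0 ≤ q) (hq1 : q < 1)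
    {p s : A} (hp : IsStarProjection p) (hs : ‖s‖ ≤ 1) (h : Commute p s) :
    Commute p (weightSum q s) := by
  have h' : Commute p (star s) := by
    have := h.star_star
    rwa [hp.isSelfAdjoint.star_eq] at this
  rw [Commute, SemiconjBy, ← ((hasSum_weightSum hq0 hq1 hs).mul_left p).tsum_eq,
    ← ((hasSum_weightSum hq0 hq1 hs).mul_right p).tsum_eq]
  simp only [mul_smul_comm, smul_mul_assoc, (commute_shiftTerm h h' _).eq]

theorem vert_mem (v : Vert2) : vert v ∈ graphSubalgebra E2 := GraphCStar.gen_mem E2 _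

theorem vertSum_mem : vertSum vert ∈ graphSubalgebra E2 :=
  add_mem (add_mem (vert_mem _) (vert_mem _)) (vert_mem _)

theorem coe_S1 : (S1 : CStar (cuntzKrieger E2)) = isoOne edge := rfl

theorem coe_S2 : (S2 : CStar (cuntzKrieger E2)) = isoTwo edge := rfl

theorem coe_shiftTerm (s : QuantumBall4) (k : ℕ) :
    ((shiftTerm s k : QuantumBall4) : CStar (cuntzKrieger E2)) = shiftTerm (s : CStar _) k := by
  induction k with
  | zero => rfl
  | succ k ih => rw [shiftTerm, shiftTerm, ← ih]; rfl

theorem hasSum_quantumBall4_iff {f : ℕ → QuantumBall4} {y : QuantumBall4} :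
    HasSum f y ↔ HasSum (fun k => (f k : CStar (cuntzKrieger E2))) (y : CStar (cuntzKrieger E2)) :=
  (Topology.IsInducing.hasSum_iff
    (g := NonUnitalStarSubalgebraClass.subtype (graphSubalgebra E2))
    Topology.IsInducing.subtypeVal f y).symm

theorem hasSum_weightSum_quantumBall4 {q : ℝ} (hq0 : 0 ≤ q) (hq1 : q < 1) {s y : QuantumBall4}
    (hs : ‖(s : CStar (cuntzKrieger E2))‖ ≤ 1)
    (hy : (y : CStar (cuntzKrieger E2)) = weightSum q (s : CStar (cuntzKrieger E2))) :
    HasSum (fun k => (weight q k : ℂ) • shiftTerm s k) y := by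
  rw [hasSum_quantumBall4_iff, hy]
  convert hasSum_weightSum hq0 hq1 hs using 2 with k
  exact congrArg ((weight q k : ℂ) • ·) (coe_shiftTerm s k)

theorem isClosed_graphSubalgebra :
    IsClosed (graphSubalgebra E2 : Set (CStar (cuntzKrieger E2))) :=
  NonUnitalStarSubalgebra.isClosed_topologicalClosure _

theorem weightSum_mem {q : ℝ} (hq0 : 0 ≤ q) (hq1 : q < 1) (s : QuantumBall4)
    (hs : ‖(s : CStar (cuntzKrieger E2))‖ ≤ 1) :
    weightSum q (s : CStar (cuntzKrieger E2)) ∈ graphSubalgebra E2 := by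
  refine isClosed_graphSubalgebra.mem_of_tendsto (hasSum_weightSum hq0 hq1 hs).tendsto_sum_nat
    (Filter.Eventually.of_forall fun n => sum_mem fun k _ => ?_)
  rw [← coe_shiftTerm]
  exact SMulMemClass.smul_mem _ (shiftTerm s k).2

theorem norm_mul_proj_le {A : Type*} [CStarAlgebra A] {p : A} (hp : IsStarProjection p)
    {s : A} (hs : ‖s‖ ≤ 1) : ‖s * p‖ ≤ 1 :=
  (norm_mul_le _ _).trans (mul_le_one₀ hs (norm_nonneg _) hp.norm_le)

end Main

end QBall

end

theorem mainTheorem3 (q : ℝ) (hq0 : 0 < q) (hq1 : q < 1) :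
    ∃ Φ : QBall.CStarBall4 q hq0 hq1 ≃⋆ₐ[ℂ] QBall.QuantumBall4,
      HasSum (fun k : ℕ => (QBall.weight q k : ℂ) • QBall.shiftTerm QBall.S1 k)
        (Φ (QBall.x1 q hq0 hq1)) ∧
      HasSum (fun k : ℕ => (QBall.weight q k : ℂ) • QBall.shiftTerm QBall.S2 k)
        (Φ (QBall.x2 q hq0 hq1)) := by
  open QBall in
  open scoped CStarAlgebra in
  obtain ⟨s₁, s₂, hs, hs1, hs2⟩ := (ballPair_x q hq0 hq1).exists_isoPair hq0.le hq1
  have hck := e2Family_gen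
  have ht := hck.isoPair
  set P := vertSum vert with hPdef
  set t₁ := isoOne edge with ht1def
  set t₂ := isoTwo edge + (1 - P) with ht2def
  have hP := hck.isStarProjection_vertSum
  have hPP : P * P = P := hP.isIdempotentElem
  obtain ⟨Θ, hΘ⟩ := CStar.exists_hom (ballPresentation q hq0 hq1) (cuntzKrieger E2)
    ![weightSum q t₁, weightSum q t₂] fun H _ _ _ ρ _ => by
      have := ((ht.map ρ).ballPair hq0.le hq1).ballRel
      rwa [← map_weightSum hq0.le hq1 ρ ht.norm_le₁, ← map_weightSum hq0.le hq1 ρ ht.norm_le₂]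
        at this
  have hΘ1 : Θ (x1 q hq0 hq1) = weightSum q t₁ := hΘ 0
  have hΘ2 : Θ (x2 q hq0 hq1) = weightSum q t₂ := hΘ 1
  obtain ⟨Ψ, hΨ⟩ := CStar.exists_hom (cuntzKrieger E2) (ballPresentation q hq0 hq1)
    (Sum.elim (pairVert s₁ s₂) (pairEdge s₁ s₂)) fun H _ _ _ ρ _ => by
      refine (isCuntzKrieger_iff _ _).2 ?_
      simpa only [Sum.elim_inl, Sum.elim_inr, map_pairVert, map_pairEdge] using (hs.map ρ).e2Family
  have hΨv : ∀ x, Ψ (vert x) = pairVert s₁ s₂ x := fun x => hΨ (Sum.inl x)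
  have hΨe : ∀ x, Ψ (edge x) = pairEdge s₁ s₂ x := fun x => hΨ (Sum.inr x)
  have hΨP : Ψ P = 1 := by
    rw [← vertSum_pairVert s₁ s₂]
    simp only [hPdef, vertSum, map_add, hΨv]
  have hΨt1 : Ψ t₁ = s₁ := by
    rw [← hs.isoOne_pairEdge]
    simp only [ht1def, isoOne, map_add, hΨe]
  have hΨt2 : Ψ t₂ = s₂ := by
    rw [ht2def, map_add, map_sub, map_one, hΨP, sub_self, add_zero, ← isoTwo_pairEdge s₁ s₂]
    simp only [isoTwo, map_add, hΨe]
  obtain ⟨hΘs1, hΘs2⟩ := (hs.map Θ).eq_of_weightSum_eq hq0.le hq1 ht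
    (by rw [← map_weightSum hq0.le hq1 Θ hs.norm_le₁, hs1, hΘ1])
    (by rw [← map_weightSum hq0.le hq1 Θ hs.norm_le₂, hs2, hΘ2])
  have hΨΘ : ∀ y, Ψ (Θ y) = y := by
    have : Ψ.comp Θ = StarAlgHom.id ℂ _ := by
      refine CStar.hom_ext _ fun g => ?_
      fin_cases g
      · change Ψ (Θ (x1 q hq0 hq1)) = x1 q hq0 hq1
        rw [hΘ1, map_weightSum hq0.le hq1 Ψ ht.norm_le₁, hΨt1, hs1]
      · change Ψ (Θ (x2 q hq0 hq1)) = x2 q hq0 hq1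
        rw [hΘ2, map_weightSum hq0.le hq1 Ψ ht.norm_le₂, hΨt2, hs2]
    exact fun y => congr($this y)
  have hc1 := commute_weightSum hq0.le hq1 hP ht.norm_le₁ hck.commute_isoOne
  have hc2 := commute_weightSum hq0.le hq1 hP ht.norm_le₂ hck.commute_isoTwo
  have hcg : ∀ g, Commute P (Θ (CStar.gen _ g)) := by
    intro g
    fin_cases g
    · exact hΘ1 ▸ hc1
    · exact hΘ2 ▸ hc2
  have hstar : ∀ {z}, Commute P z → Commute P (star z) := fun {z} h => by
    have := h.star_star
    rwa [hP.isSelfAdjoint.star_eq] at this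
  have hcomm : ∀ y, Commute P (Θ y) := by
    intro y
    induction y using CStar.induct with
    | closed =>
      exact isClosed_eq (continuous_const.mul (map_continuous Θ))
        ((map_continuous Θ).mul continuous_const)
    | one => rw [map_one]; exact Commute.one_right _
    | add a b ha hb => rw [map_add]; exact ha.add_right hb
    | smul c a ha => rw [map_smul]; exact ha.smul_right c
    | gen_mul g a ha => rw [map_mul]; exact (hcg g).mul_right ha
    | star_gen_mul g a ha => rw [map_mul, map_star]; exact (hstar (hcg g)).mul_right ha
  have hmul : ∀ a b, P * Θ (a * b) = P * Θ a * (P * Θ b) := fun a b => by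
    rw [map_mul, mul_assoc P (Θ a), ← mul_assoc (Θ a) P, ← (hcomm a).eq, mul_assoc P (Θ a),
      ← mul_assoc P P, hPP]
  have hst : ∀ a, P * Θ (star a) = star (P * Θ a) := fun a => by
    rw [star_mul, hP.isSelfAdjoint.star_eq, map_star, (hstar (hcomm a)).eq]
  have hz1 : P * Θ (x1 q hq0 hq1) = weightSum q (isoOne edge) := by
    rw [hΘ1, hc1.eq, ← weightSum_mul_proj hq0.le hq1 hP ht.norm_le₁ hck.commute_isoOne,
      hck.isoOne_mul_vertSum]
  have hz2 : P * Θ (x2 q hq0 hq1) = weightSum q (isoTwo edge) := by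
    rw [hΘ2, hc2.eq, ← weightSum_mul_proj hq0.le hq1 hP ht.norm_le₂ hck.commute_isoTwo,
      hck.isoTwo_add_mul_vertSum]
  have hn2 : ‖isoTwo edge‖ ≤ 1 := by
    rw [← hck.isoTwo_add_mul_vertSum]
    exact norm_mul_proj_le hP ht.norm_le₂
  have hgmem : ∀ g, P * Θ (CStar.gen _ g) ∈ graphSubalgebra E2 := by
    intro g
    fin_cases g
    · change P * Θ (x1 q hq0 hq1) ∈ _
      rw [hz1, ← coe_S1]
      exact weightSum_mem hq0.le hq1 _ ht.norm_le₁
    · change P * Θ (x2 q hq0 hq1) ∈ _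
      rw [hz2, ← coe_S2]
      exact weightSum_mem hq0.le hq1 _ hn2
  have hmem : ∀ y, P * Θ y ∈ graphSubalgebra E2 := by
    intro y
    induction y using CStar.induct with
    | closed => exact isClosed_graphSubalgebra.preimage (continuous_const.mul (map_continuous Θ))
    | one => rw [map_one, mul_one]; exact vertSum_mem
    | add a b ha hb => rw [map_add, mul_add]; exact add_mem ha hb
    | smul c a ha => rw [map_smul, mul_smul_comm]; exact SMulMemClass.smul_mem c ha
    | gen_mul g a ha => rw [hmul]; exact mul_mem (hgmem g) ha
    | star_gen_mul g a ha => rw [hmul, hst]; exact mul_mem (star_mem (hgmem g)) ha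
  have hright : ∀ z ∈ graphSubalgebra E2, P * Θ (Ψ z) = z := by
    have hE : IsClosed {z | P * Θ (Ψ z) = z} :=
      isClosed_eq (continuous_const.mul ((map_continuous Θ).comp (map_continuous Ψ)))
        continuous_id
    refine closure_minimal (fun z hz => ?_) hE
    induction hz using NonUnitalStarAlgebra.adjoin_induction with
    | mem z hz =>
      obtain ⟨x | x, rfl⟩ := hz
      · change P * Θ (Ψ (vert x)) = vert x
        rw [hΨv, map_pairVert, hΘs1, hΘs2]
        exact hck.vertSum_mul_pairVert x
      · change P * Θ (Ψ (edge x)) = edge x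
        rw [hΨe, map_pairEdge, hΘs1, hΘs2]
        exact hck.vertSum_mul_pairEdge x
    | add x y _ _ hx hy =>
      change P * Θ (Ψ (x + y)) = x + y
      rw [map_add, map_add, mul_add, hx, hy]
    | zero =>
      change P * Θ (Ψ 0) = 0
      rw [map_zero, map_zero, mul_zero]
    | mul x y _ _ hx hy =>
      change P * Θ (Ψ (x * y)) = x * y
      rw [map_mul, hmul, hx, hy]
    | smul c x _ hx =>
      change P * Θ (Ψ (c • x)) = c • x
      rw [map_smul, map_smul, mul_smul_comm, hx]
    | star x _ hx =>
      change P * Θ (Ψ (star x)) = star x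
      rw [map_star, hst, hx]
  let Φ : CStarBall4 q hq0 hq1 ≃⋆ₐ[ℂ] QuantumBall4 := {
    toFun := fun y => ⟨P * Θ y, hmem y⟩
    invFun := fun z => Ψ z
    left_inv := fun y => by
      change Ψ (P * Θ y) = y
      rw [map_mul, hΨP, one_mul, hΨΘ]
    right_inv := fun z => Subtype.ext (hright z z.2)
    map_mul' := fun a b => Subtype.ext (hmul a b)
    map_add' := fun a b => Subtype.ext (by
      change P * Θ (a + b) = P * Θ a + P * Θ b
      rw [map_add, mul_add])
    map_star' := fun a => Subtype.ext (hst a)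
    map_smul' := fun c a => Subtype.ext (by
      change P * Θ (c • a) = c • (P * Θ a)
      rw [map_smul, mul_smul_comm]) }
  exact ⟨Φ, hasSum_weightSum_quantumBall4 hq0.le hq1 ht.norm_le₁ hz1,
    hasSum_weightSum_quantumBall4 hq0.le hq1 hn2 hz2⟩
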